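/- **Setting.** Let $K$ be the number of arms, $\Theta$ an arbitrary set, $\mu_1,\dots,\mu_K:\Theta\to\mathbb R$ arbitrary known functions, $\theta^*\in\Theta$ the unknown true parameter, and $k^*\in\arg\max_k\mu_k(\theta^*)$ the optimal arm. In each round $t=1,2,\dots$ an arm $k_t$ is pulled and a reward is observed; given the past and $k_t=k$, the reward has a fixed (unknown) law with mean $\mu_k(\theta^*)$ that is sub-Gaussian with variance proxy $\sigma^2$, where $\sigma>0$ is known. Let $n_k(t)$ be the number of pulls of arm $k$ in the first $t$ rounds and $\hat\mu_k(t)$ the average of the rewards obtained from them. The regret is $\mathrm{Reg}(T)=\sum_{t=1}^T(\mu_{k^*}(\theta^*)-\mu_{k_t}(\theta^*))$. **Algorithms.** Let $\alpha>3$ and $\beta>1$. In round $t+1$ both algorithms form $$\hat\Theta_t=\Big\{\theta\in\Theta:\ |\mu_k(\theta)-\hat\mu_k(t)|<\sqrt{2\alpha\sigma^2\log t/n_k(t)}\ \text{ for all }k\Big\},$$ where the right-hand side is $+\infty$ if $n_k(t)=0$, and let $\mathcal C_t$ be the set of arms $k$ such that $\mu_k(\theta)=\max_\ell\mu_\ell(\theta)$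 for some $\theta\in\hat\Theta_t$ (all arms, if $\hat\Theta_t=\emptyset$). UCB-C pulls an arm of $\mathcal C_t$ maximizing $\hat\mu_k(t)+\sqrt{2\alpha\sigma^2\log t/n_k(t)}$ (which is $+\infty$ if $n_k(t)=0$). TS-C draws independent samples $S_{k,t}\sim\mathcal N(\hat\mu_k(t),\beta\sigma^2/n_k(t))$ and pulls an arm of $\mathcal C_t$ maximizing $S_{k,t}$ over $\mathcal C_t$; arms of $\mathcal C_t$ with $n_k(t)=0$ are pulled first. Ties are broken in any way that depends only on the past (possibly at random). **Competitive arms.** For $\varepsilon>0$ let $\Theta^{*(\varepsilon)}=\{\theta\in\Theta:|\mu_{k^*}(\theta^*)-\mu_{k^*}(\theta)|<\varepsilon\}$. An arm $k$ is competitive if for every $\varepsilon>0$ there is $\theta\in\Theta^{*(\varepsilon)}$ with $\mu_k(\theta)=\max_\ell\mu_\ell(\theta)$, and non-competitive otherwise. Let $C(\theta^*)$ be the number of competitive arms. **Theorem 1 (Expected regret scaling).** For each of UCB-C and TS-C there are constants $c_1,c_2\ge 0$, depending only on $(\mu_k)_k,\theta^*,k^*,\sigma,\alpha$ (and $\beta$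 for TS-C), but not on $T$, the reward laws or the tie-breaking, such that for all $T\ge 2$ $$\mathbb E[\mathrm{Reg}(T)]\le (C(\theta^*)-1)\,c_1\log T+(K-C(\theta^*))\,c_2 .$$ In particular, if $C(\theta^*)=1$, the expected regret is bounded: $\mathbb E[\mathrm{Reg}(T)]\le (K-1)c_2$ for all $T$. -/

import Mathlib

open MeasureTheory ProbabilityTheory
open scoped NNReal ENNReal

noncomputable section

namespace StructuredBandit

/-! ### Competitive arms -/

/-- `Θ^{*(ε)} = {θ : |μ_{k*}(θ*) - μ_{k*}(θ)| < ε}`, the `ε`-neighbourhood of the level set of the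
mean reward function of the arm `kstar` through `θstar`. -/
def levelNbhd {K : ℕ} {Θ : Type*} (μ : Fin K → Θ → ℝ) (kstar : Fin K) (θstar : Θ) (ε : ℝ) :
    Set Θ :=
  {θ | |μ kstar θstar - μ kstar θ| < ε}

/-- Arm `k` is competitive with respect to a set `S` of parameters: its mean reward is the highest
among all arms for some `θ ∈ S`. -/
def CompetitiveOn {K : ℕ} {Θ : Type*} (μ : Fin K → Θ → ℝ) (S : Set Θ) (k : Fin K) : Prop :=
  ∃ θ ∈ S, ∀ l, μ l θ ≤ μ k θ

/-- Arm `k` is competitive: for every `ε > 0` it is optimal for some `θ` in the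
`ε`-neighbourhood of the level set of the optimal arm. -/
def Competitive {K : ℕ} {Θ : Type*} (μ : Fin K → Θ → ℝ) (kstar : Fin K) (θstar : Θ)
    (k : Fin K) : Prop :=
  ∀ ε : ℝ, 0 < ε → CompetitiveOn μ (levelNbhd μ kstar θstar ε) k

/-- `C(θ*)`, the number of competitive arms. -/
def numCompetitive {K : ℕ} {Θ : Type*} (μ : Fin K → Θ → ℝ) (kstar : Fin K) (θstar : Θ) : ℕ :=
  {k : Fin K | Competitive μ kstar θstar k}.ncard

/-! ### Histories and the empirical quantities computed from them -/

/-- The pulled arms and observed rewards of the first `t` rounds (round `i + 1` has index `i`). -/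
abbrev History (K t : ℕ) : Type := Fin t → Fin K × ℝ

/-- `n_k(t)`, the number of pulls of arm `k` in the first `t` rounds. -/
def pulls {K t : ℕ} (h : History K t) (k : Fin K) : ℕ :=
  (Finset.univ.filter fun i => (h i).1 = k).card

/-- `μ̂_k(t)`, the average of the rewards obtained from arm `k` in the first `t` rounds
(used only when arm `k` has been pulled). -/
def empMean {K t : ℕ} (h : History K t) (k : Fin K) : ℝ :=
  (∑ i ∈ Finset.univ.filter (fun i => (h i).1 = k), (h i).2) / (pulls h k : ℝ)

/-- `√(2 α σ² log t / n_k(t))`, to be read as `+∞` when `n_k(t) = 0`; this case is treated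
separately wherever the width is used. -/
def width {K t : ℕ} (α : ℝ) (σ : ℝ≥0) (h : History K t) (k : Fin K) : ℝ :=
  Real.sqrt (2 * α * (σ : ℝ) ^ 2 * Real.log (t : ℝ) / (pulls h k : ℝ))

/-- The confidence set of parameters. An arm that has not been pulled has infinite width and
imposes no constraint. -/
def confSet {K t : ℕ} {Θ : Type*} (μ : Fin K → Θ → ℝ) (α : ℝ) (σ : ℝ≥0) (h : History K t) :
    Set Θ :=
  {θ | ∀ k, pulls h k ≠ 0 → |μ k θ - empMean h k| < width α σ h k}

/-- The set `C_t` of arms among which the algorithms choose: all arms when the confidence set is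
empty, and otherwise the arms that are optimal for some parameter of the confidence set. -/
def candidates {K t : ℕ} {Θ : Type*} (μ : Fin K → Θ → ℝ) (α : ℝ) (σ : ℝ≥0) (h : History K t) :
    Set (Fin K) :=
  {k | confSet μ α σ h = ∅ ∨ CompetitiveOn μ (confSet μ α σ h) k}

/-- The UCB index `μ̂_k(t) + √(2 α σ² log t / n_k(t))`, infinite for an arm not yet pulled. -/
def ucbIndex {K t : ℕ} (α : ℝ) (σ : ℝ≥0) (h : History K t) (k : Fin K) : EReal :=
  if pulls h k = 0 then ⊤ else ((empMean h k + width α σ h k : ℝ) : EReal)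

/-! ### Policies and the two algorithms -/

/-- A policy: for every `t`, the conditional law of the arm pulled in round `t + 1` given the
history of the first `t` rounds. -/
abbrev Policy (K : ℕ) : Type := (t : ℕ) → Kernel (History K t) (Fin K)

/-- `π` is a UCB-C policy: every arm that it can pull maximizes the UCB index over `C_t`
(ties may be broken in any way, also at random). -/
def IsUCBC {K : ℕ} {Θ : Type*} (μ : Fin K → Θ → ℝ) (α : ℝ) (σ : ℝ≥0) (π : Policy K) : Prop :=
  ∀ (t : ℕ) (h : History K t) (k : Fin K), π t h {k} ≠ 0 →
    k ∈ candidates μ α σ h ∧ ∀ j ∈ candidates μ α σ h, ucbIndex α σ h j ≤ ucbIndex α σ h k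

/-- The joint law of independent Thompson samples `S_k ∼ N(μ̂_k(t), β σ² / n_k(t))`
(only the samples of arms that have been pulled are used). -/
def tsLaw {K t : ℕ} (β σ : ℝ≥0) (h : History K t) : Measure (Fin K → ℝ) :=
  Measure.pi fun k => gaussianReal (empMean h k) (β * σ ^ 2 / (pulls h k : ℝ≥0))

/-- `π` is a TS-C policy: it pulls the arm of `C_t` with the largest Thompson sample, that is, it
pulls `k ∈ C_t` with the probability that the sample of `k` is the largest one over `C_t`. The
posterior of an arm that has not been pulled has infinite variance; as for the UCB index, arms of
`C_t` that have not been pulled have priority (ties among them are broken in any way). -/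
def IsTSC {K : ℕ} {Θ : Type*} (μ : Fin K → Θ → ℝ) (α : ℝ) (β σ : ℝ≥0) (π : Policy K) : Prop :=
  ∀ (t : ℕ) (h : History K t),
    ((∃ k ∈ candidates μ α σ h, pulls h k = 0) →
      ∀ k, π t h {k} ≠ 0 → k ∈ candidates μ α σ h ∧ pulls h k = 0) ∧
    ((∀ k ∈ candidates μ α σ h, pulls h k ≠ 0) →
      (∀ k ∈ candidates μ α σ h,
        π t h {k} = tsLaw β σ h {S | ∀ j ∈ candidates μ α σ h, S j ≤ S k}) ∧
      ∀ k ∉ candidates μ α σ h, π t h {k} = 0)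

/-! ### Interaction of a policy with the environment, and regret -/

/-- The history of the first `t` rounds of the process of pulled arms `A` and rewards `R`;
`A t` is the arm pulled in round `t + 1` and `R t` the reward observed in that round. -/
def history {Ω : Type*} {K : ℕ} (A : ℕ → Ω → Fin K) (R : ℕ → Ω → ℝ) (t : ℕ) (ω : Ω) :
    History K t :=
  fun i => (A i ω, R i ω)

/-- The process `(A, R)` results from running the policy `π` when the rewards of arm `k` have law
`ν k`: given the past, the next arm has law `π t (history)`, and given the past and the arm `k`
just pulled, the reward has law `ν k`. -/
structure IsRun {Ω : Type*} [MeasurableSpace Ω] {K : ℕ} (π : Policy K) (ν : Kernel (Fin K) ℝ)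
    (P : Measure Ω) (A : ℕ → Ω → Fin K) (R : ℕ → Ω → ℝ) : Prop where
  measurable_arm : ∀ t, Measurable (A t)
  measurable_reward : ∀ t, Measurable (R t)
  arm_law : ∀ t, HasCondDistrib (A t) (history A R t) (π t) P
  reward_law : ∀ t, HasCondDistrib (R t) (fun ω => (history A R t ω, A t ω))
    (Kernel.prodMkLeft (History K t) ν) P

/-- The reward laws `ν` are compatible with the true parameter: arm `k` has mean reward `μ_k(θ*)`
and is sub-Gaussian with variance proxy `σ²`. -/
def IsRewardLaw {K : ℕ} {Θ : Type*} (μ : Fin K → Θ → ℝ) (θstar : Θ) (σ : ℝ≥0)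
    (ν : Kernel (Fin K) ℝ) : Prop :=
  ∀ k, ∫ x, x ∂(ν k) = μ k θstar ∧ HasSubgaussianMGF (fun x => x - μ k θstar) (σ ^ 2) (ν k)

/-- `E[Reg(T)]`, with `Reg(T) = ∑_{t = 1}^{T} (μ_{k*}(θ*) - μ_{k_t}(θ*))`. -/
def expRegret {Ω : Type*} [MeasurableSpace Ω] {K : ℕ} {Θ : Type*} (μ : Fin K → Θ → ℝ)
    (kstar : Fin K) (θstar : Θ) (P : Measure Ω) (A : ℕ → Ω → Fin K) (T : ℕ) : ℝ :=
  ∫ ω, ∑ t ∈ Finset.range T, (μ kstar θstar - μ (A t ω) θstar) ∂P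

end StructuredBandit

end

/-
The regret is the sum over the suboptimal arms of the gap times the expected number of pulls. Call
a sequence of events summably rare if its probabilities have a summable bound that is uniform over
all runs: on such events an arm is pulled only boundedly often in expectation.

The key point is that the optimal arm `k*` has at least `M log t` pulls at time `t`, for every `M`
and outside a summably rare event. By pigeonhole some arm `l` is pulled in a constant fraction of
the rounds, after having been pulled linearly often. For UCB-C, a pull of such an `l` means that
its index, which is close to `μ_l(θ*)`, beats that of `k*`, so `k*` has been pulled often already.
For TS-C, as long as `k*` has few pulls, its posterior is much wider than that of `l`, and since
`β > 1` the Gaussian tail bounds make the conditional probability of pulling `k*` at least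
`t ^ (-ρ)` times that of pulling `l`, up to `1 / t`, with some `ρ < 1`. An exponential
supermartingale in the two pull counts then shows that `l` is rarely pulled linearly often while
`k*` is pulled only logarithmically often.

Once `k*` has `M log t` pulls with `M` large, every `θ` in the confidence set has `μ_{k*}(θ)` within
`ε` of `μ_{k*}(θ*)`, so a non-competitive arm is not a candidate. A suboptimal arm with `L log t`
pulls has an index or sample below `μ_{k*}(θ*)` outside a summably rare event, so its expected
number of pulls is `O(log T)`.
-/

namespace StructuredBandit

open Filter Topology

/-! ### Counting -/

section Counting

variable (p : ℕ → Prop) [DecidablePred p]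

lemma count_and_count_lt (s t : ℕ) :
    Nat.count (fun i => p i ∧ Nat.count p i < s) t = min (Nat.count p t) s := by
  induction t with
  | zero => simp
  | succ t ih =>
    simp only [Nat.count_succ, ih]
    by_cases h : p t <;> by_cases h' : Nat.count p t < s <;> simp [h, h'] <;> omega

lemma count_and_le_count (s t : ℕ) :
    Nat.count (fun i => p i ∧ s ≤ Nat.count p i) t = Nat.count p t - s := by
  induction t with
  | zero => simp
  | succ t ih =>
    simp only [Nat.count_succ, ih]
    by_cases h : p t <;> by_cases h' : s ≤ Nat.count p t <;> simp [h, h'] <;> omega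

lemma count_and_count_lt_le {x : ℝ} (hx : 0 ≤ x) (t : ℕ) :
    (Nat.count (fun i => p i ∧ (Nat.count p i : ℝ) < x) t : ℝ) ≤ x + 1 := by
  simp only [← Nat.lt_ceil, count_and_count_lt]
  exact (Nat.cast_le.2 (min_le_right _ _)).trans (Nat.ceil_lt_add_one hx).le

lemma sum_count_eq {ι : Type*} [Fintype ι] [DecidableEq ι] (f : ℕ → ι) (t : ℕ) :
    ∑ k, Nat.count (fun i => f i = k) t = t := by
  simpa [Nat.count_eq_card_filter_range] using
    (Finset.card_eq_sum_card_fiberwise (f := f) (s := Finset.range t) (t := Finset.univ)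
      fun _ _ => Finset.mem_univ _).symm

/-- Some value is taken `t / K` times, hence half of these times after it has already been taken
`t / (2 K)` times. -/
lemma exists_div_le_count {ι : Type*} [Fintype ι] [DecidableEq ι] (f : ℕ → ι) (t : ℕ)
    [Nonempty ι] :
    ∃ l, t / (2 * Fintype.card ι) ≤ Nat.count (fun i => f i = l ∧
      t / (2 * Fintype.card ι) ≤ Nat.count (fun j => f j = l) i) t := by
  obtain ⟨l, -, hl⟩ : ∃ l ∈ Finset.univ, t / Fintype.card ι ≤ Nat.count (fun i => f i = l) t := by
    refine Finset.exists_le_of_sum_le Finset.univ_nonempty ?_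
    rw [sum_count_eq, Finset.sum_const, Finset.card_univ, smul_eq_mul]
    exact Nat.mul_div_le t _
  refine ⟨l, ?_⟩
  rw [count_and_le_count, mul_comm, ← Nat.div_div_eq_div_mul]
  omega

lemma exists_ne_le_count_and_le_count {ι : Type*} [Fintype ι] [DecidableEq ι] (f : ℕ → ι) {t : ℕ}
    {k : ι} (hk : Nat.count (fun i => f i = k) t < t / (2 * Fintype.card ι)) :
    ∃ l ≠ k, t / (2 * Fintype.card ι) ≤ Nat.count (fun i => f i = l ∧
      t / (2 * Fintype.card ι) ≤ Nat.count (fun j => f j = l) i) t := by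
  have : Nonempty ι := ⟨k⟩
  obtain ⟨l, hl⟩ := exists_div_le_count f t
  refine ⟨l, ?_, hl⟩
  rintro rfl
  exact hk.not_ge (hl.trans (Nat.count_mono_left fun i _ h => h.1))

end Counting

/-! ### Histories of a run -/

/-- The number of pulls of arm `k` in the first `t` rounds of a run. -/
def pullCount {Ω : Type*} {K : ℕ} (A : ℕ → Ω → Fin K) (k : Fin K) (t : ℕ) (ω : Ω) : ℕ :=
  Nat.count (fun i => A i ω = k) t

/-- The sum of `r - m` over the first `s` rewards `r` of arm `k`, as far as they are observed in
the first `t` rounds. For fixed `s` it is a sum of martingale differences, to which the empirical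
mean reduces when `s` is the number of pulls. -/
noncomputable def truncSum {Ω : Type*} {K : ℕ} (A : ℕ → Ω → Fin K) (R : ℕ → Ω → ℝ) (m : ℝ)
    (k : Fin K) (s t : ℕ) (ω : Ω) : ℝ :=
  ∑ i ∈ Finset.range t, if A i ω = k ∧ pullCount A k i ω < s then R i ω - m else 0

/-- The σ-algebra generated by the first `t` rounds. -/
abbrev past {Ω : Type*} {K : ℕ} (A : ℕ → Ω → Fin K) (R : ℕ → Ω → ℝ) (t : ℕ) :
    MeasurableSpace Ω :=
  MeasurableSpace.comap (history A R t) inferInstance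

section Pathwise

variable {Ω : Type*} {K : ℕ} {A : ℕ → Ω → Fin K} {R : ℕ → Ω → ℝ} {k : Fin K} {ω : Ω}

lemma pulls_history (t : ℕ) : pulls (history A R t ω) k = pullCount A k t ω := by
  rw [pulls, pullCount, Nat.count_eq_card_filter_range, Finset.card_filter, Finset.card_filter]
  exact Fin.sum_univ_eq_sum_range (fun i => if A i ω = k then 1 else 0) t

lemma pullCount_mul_empMean_sub (m : ℝ) {t : ℕ} (h : pullCount A k t ω ≠ 0) :
    pullCount A k t ω * (empMean (history A R t ω) k - m) =
      ∑ i ∈ Finset.range t, if A i ω = k then R i ω - m else 0 := by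
  have hsum : ∑ i with (history A R t ω i).1 = k, (history A R t ω i).2 =
      ∑ i ∈ Finset.range t with A i ω = k, R i ω := by
    simp only [Finset.sum_filter]
    exact Fin.sum_univ_eq_sum_range (fun i => if A i ω = k then R i ω else 0) t
  have hcard : (Finset.filter (fun i => A i ω = k) (Finset.range t)).card = pullCount A k t ω :=
    (Nat.count_eq_card_filter_range _ t).symm
  rw [← Finset.sum_filter, Finset.sum_sub_distrib, Finset.sum_const, hcard, nsmul_eq_mul, empMean,
    hsum, pulls_history, mul_sub, mul_div_cancel₀ _ (Nat.cast_ne_zero.2 h)]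

lemma truncSum_pullCount (m : ℝ) {i t : ℕ} (hit : i ≤ t) (h : pullCount A k i ω ≠ 0) :
    truncSum A R m k (pullCount A k i ω) t ω =
      pullCount A k i ω * (empMean (history A R i ω) k - m) := by
  have hlt (j : ℕ) (hj : A j ω = k) : pullCount A k j ω < pullCount A k i ω ↔ j < i :=
    ⟨Nat.lt_of_count_lt_count, Nat.count_strict_mono hj⟩
  rw [pullCount_mul_empMean_sub m h, truncSum]
  refine (Finset.sum_subset_zero_on_sdiff (Finset.range_mono hit) (fun j hj => ?_)
    fun j hj => ?_).symm
  · refine if_neg fun h' => (Finset.mem_sdiff.1 hj).2 (Finset.mem_range.2 ((hlt j h'.1).1 h'.2))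
  · have hj := Finset.mem_range.1 hj
    exact if_congr ⟨fun h' => ⟨h', (hlt j h').2 hj⟩, And.left⟩ rfl rfl

end Pathwise

section Past

variable {Ω : Type*} {K : ℕ} {A : ℕ → Ω → Fin K} {R : ℕ → Ω → ℝ}

lemma measurable_arm_past {i t : ℕ} (h : i < t) : Measurable[past A R t] (A i) := by
  have hproj : Measurable fun x : History K t => (x ⟨i, h⟩).1 := by fun_prop
  exact hproj.comp (comap_measurable (history A R t))

lemma measurable_reward_past {i t : ℕ} (h : i < t) : Measurable[past A R t] (R i) := by
  have hproj : Measurable fun x : History K t => (x ⟨i, h⟩).2 := by fun_prop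
  exact hproj.comp (comap_measurable (history A R t))

lemma measurableSet_arm_past {i t : ℕ} (h : i < t) (k : Fin K) :
    MeasurableSet[past A R t] {ω | A i ω = k} :=
  measurable_arm_past h (measurableSet_singleton k)

lemma past_mono {i t : ℕ} (h : i ≤ t) : past A R i ≤ past A R t := by
  have hrestrict : Measurable fun (x : History K t) (j : Fin i) => x (Fin.castLE h j) := by fun_prop
  exact (hrestrict.comp (comap_measurable (history A R t))).comap_le

lemma measurableSet_past_history {t : ℕ} {s : Set (History K t)} (hs : MeasurableSet s) :
    MeasurableSet[past A R t] {ω | history A R t ω ∈ s} :=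
  ⟨s, hs, rfl⟩

lemma measurable_count {Ω : Type*} {m : MeasurableSpace Ω} {p : ℕ → Ω → Prop}
    [∀ i, DecidablePred (p i)] {t : ℕ} (hp : ∀ i < t, MeasurableSet {ω | p i ω}) :
    Measurable fun ω => Nat.count (p · ω) t := by
  simp only [Nat.count_eq_card_filter_range, Finset.card_filter]
  exact Finset.measurable_fun_sum _ fun i hi =>
    Measurable.ite (hp i (Finset.mem_range.1 hi)) measurable_const measurable_const

lemma measurable_pullCount_past (t : ℕ) (k : Fin K) :
    Measurable[past A R t] (pullCount A k t) :=
  measurable_count fun _ hi => measurableSet_arm_past hi k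

lemma measurable_truncSum_past (m : ℝ) (k : Fin K) (s t : ℕ) :
    Measurable[past A R t] (truncSum A R m k s t) := by
  refine Finset.measurable_fun_sum _ fun i hi => ?_
  have hi := Finset.mem_range.1 hi
  refine Measurable.ite ((measurableSet_arm_past hi k).inter ?_)
    ((measurable_reward_past hi).sub measurable_const) measurable_const
  exact past_mono hi.le _ (measurable_pullCount_past i k (measurableSet_Iio (a := s)))

end Past

/-! ### Conditional laws along a run -/

section ConditionalLaws

variable {Ω : Type*} [MeasurableSpace Ω] {K : ℕ} {π : Policy K} {ν : Kernel (Fin K) ℝ}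
  {P : Measure Ω} {A : ℕ → Ω → Fin K} {R : ℕ → Ω → ℝ}

lemma IsRun.measurable_history (hrun : IsRun π ν P A R) (t : ℕ) : Measurable (history A R t) :=
  measurable_pi_iff.2 fun i => (hrun.measurable_arm i).prodMk (hrun.measurable_reward i)

lemma IsRun.past_le (hrun : IsRun π ν P A R) (t : ℕ) : past A R t ≤ ‹MeasurableSpace Ω› :=
  (hrun.measurable_history t).comap_le

lemma IsRun.measurableSet_arm (hrun : IsRun π ν P A R) (t : ℕ) (k : Fin K) :
    MeasurableSet {ω | A t ω = k} :=
  hrun.measurable_arm t (measurableSet_singleton k)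

variable [IsProbabilityMeasure P]

lemma IsRun.setLIntegral_arm [∀ t, IsMarkovKernel (π t)] (hrun : IsRun π ν P A R) (t : ℕ)
    (k : Fin K) {g : Ω → ℝ≥0∞} (hg : Measurable[past A R t] g) :
    ∫⁻ ω in {ω | A t ω = k}, g ω ∂P = ∫⁻ ω, g ω * π t (history A R t ω) {k} ∂P := by
  obtain ⟨g, hgm, rfl⟩ := hg.exists_eq_measurable_comp
  have hgfst : Measurable fun x : History K t × Fin K => g x.1 := hgm.comp measurable_fst
  have hH := hrun.measurable_history t
  have := Measure.isProbabilityMeasure_map (μ := P) hH.aemeasurable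
  have hpre : {ω | A t ω = k} =
      (fun ω => (history A R t ω, A t ω)) ⁻¹' Set.univ ×ˢ {k} := by ext; simp
  calc ∫⁻ ω in {ω | A t ω = k}, (g ∘ history A R t) ω ∂P
      = ∫⁻ x in Set.univ ×ˢ {k}, g x.1 ∂(P.map (history A R t) ⊗ₘ π t) := by
        rw [← (hrun.arm_law t).map_eq, setLIntegral_map (MeasurableSet.univ.prod
          (measurableSet_singleton k)) hgfst (hH.prodMk (hrun.measurable_arm t)),
          ← hpre]
        rfl
    _ = ∫⁻ h, g h * π t h {k} ∂(P.map (history A R t)) := by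
        rw [Measure.setLIntegral_compProd hgfst MeasurableSet.univ
          (measurableSet_singleton k)]
        simp
    _ = _ := lintegral_map (hgm.mul ((π t).measurable_coe (measurableSet_singleton k))) hH

lemma IsRun.setLIntegral_reward [IsMarkovKernel ν] (hrun : IsRun π ν P A R) (t : ℕ) (k : Fin K)
    {g : Ω → ℝ≥0∞} (hg : Measurable[past A R t] g) {f : ℝ → ℝ≥0∞} (hf : Measurable f) :
    ∫⁻ ω in {ω | A t ω = k}, g ω * f (R t ω) ∂P =
      (∫⁻ ω in {ω | A t ω = k}, g ω ∂P) * ∫⁻ x, f x ∂ν k := by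
  obtain ⟨g, hgm, rfl⟩ := hg.exists_eq_measurable_comp
  have hgfst : Measurable fun x : History K t × Fin K => g x.1 := hgm.comp measurable_fst
  have hHA := (hrun.measurable_history t).prodMk (hrun.measurable_arm t)
  have := Measure.isProbabilityMeasure_map (μ := P) hHA.aemeasurable
  set S : Set (History K t × Fin K) := Set.univ ×ˢ {k}
  have hS : MeasurableSet S := MeasurableSet.univ.prod (measurableSet_singleton k)
  have hgf : Measurable fun x : (History K t × Fin K) × ℝ => g x.1.1 * f x.2 := by fun_prop
  have hpre : {ω | A t ω = k} = (fun ω => (history A R t ω, A t ω)) ⁻¹' S := by ext; simp [S]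
  have hpre' : {ω | A t ω = k} =
      (fun ω => ((history A R t ω, A t ω), R t ω)) ⁻¹' S ×ˢ Set.univ := by ext; simp [S]
  calc ∫⁻ ω in {ω | A t ω = k}, (g ∘ history A R t) ω * f (R t ω) ∂P
      = ∫⁻ x in S ×ˢ Set.univ, g x.1.1 * f x.2 ∂((P.map fun ω => (history A R t ω, A t ω)) ⊗ₘ
          Kernel.prodMkLeft (History K t) ν) := by
        rw [← (hrun.reward_law t).map_eq, setLIntegral_map (hS.prod MeasurableSet.univ) hgf
          (hHA.prodMk (hrun.measurable_reward t)), ← hpre']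
        rfl
    _ = ∫⁻ x in S, g x.1 * ∫⁻ r, f r ∂ν k ∂(P.map fun ω => (history A R t ω, A t ω)) := by
        rw [Measure.setLIntegral_compProd hgf hS MeasurableSet.univ]
        refine setLIntegral_congr_fun hS fun x hx => ?_
        simp only [Measure.restrict_univ, Kernel.prodMkLeft_apply, lintegral_const_mul _ hf]
        rw [show x.2 = k from hx.2]
    _ = _ := by
        rw [lintegral_mul_const _ hgfst,
          setLIntegral_map hS hgfst hHA, ← hpre]
        rfl

lemma IsRun.measure_inter_eq [∀ t, IsMarkovKernel (π t)] (hrun : IsRun π ν P A R) (t : ℕ)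
    (k : Fin K) {B : Set Ω} (hB : MeasurableSet[past A R t] B) :
    P ({ω | A t ω = k} ∩ B) = ∫⁻ ω in B, π t (history A R t ω) {k} ∂P := by
  have hBm := hrun.past_le t _ hB
  have hone : Measurable[past A R t] (B.indicator (1 : Ω → ℝ≥0∞)) := measurable_const.indicator hB
  rw [Set.inter_comm, ← Measure.restrict_apply hBm, ← lintegral_indicator_one hBm,
    hrun.setLIntegral_arm t k hone, ← lintegral_indicator hBm]
  exact lintegral_congr fun ω => by by_cases hω : ω ∈ B <;> simp [hω]

lemma IsRun.ae_apply_ne_zero [∀ t, IsMarkovKernel (π t)] (hrun : IsRun π ν P A R) :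
    ∀ᵐ ω ∂P, ∀ t, π t (history A R t ω) {A t ω} ≠ 0 := by
  have hnull (t : ℕ) (k : Fin K) : ∀ᵐ ω ∂P, A t ω = k → π t (history A R t ω) {k} ≠ 0 := by
    have hB : MeasurableSet[past A R t] {ω | π t (history A R t ω) {k} = 0} :=
      measurableSet_past_history
        ((π t).measurable_coe (measurableSet_singleton k) (measurableSet_singleton 0))
    refine measure_mono_null (fun ω hω => ?_) ((hrun.measure_inter_eq t k hB).trans
      ((setLIntegral_congr_fun (hrun.past_le t _ hB) fun ω hω => hω).trans lintegral_zero))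
    simpa [Classical.not_imp] using hω
  filter_upwards [ae_all_iff.2 fun t => ae_all_iff.2 (hnull t)] with ω hω t using hω t _ rfl

lemma IsRun.measureReal_inter_le [∀ t, IsMarkovKernel (π t)] (hrun : IsRun π ν P A R) (t : ℕ)
    (k : Fin K) {B : Set Ω} (hB : MeasurableSet[past A R t] B) {c : ℝ} (hc : 0 ≤ c)
    (h : ∀ ω ∈ B, (π t (history A R t ω)).real {k} ≤ c) :
    P.real ({ω | A t ω = k} ∩ B) ≤ c := by
  refine ENNReal.toReal_le_of_le_ofReal hc ?_
  calc P ({ω | A t ω = k} ∩ B) = ∫⁻ ω in B, π t (history A R t ω) {k} ∂P :=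
        hrun.measure_inter_eq t k hB
    _ ≤ ∫⁻ _ in B, ENNReal.ofReal c ∂P := setLIntegral_mono measurable_const fun _ hω =>
        (ENNReal.le_ofReal_iff_toReal_le (measure_ne_top _ _) hc).2 (h _ hω)
    _ ≤ ENNReal.ofReal c := by
        rw [setLIntegral_const]
        exact mul_le_of_le_one_right' prob_le_one

end ConditionalLaws

/-! ### Concentration -/

section SubGaussian

variable {Ω : Type*} [MeasurableSpace Ω] {P : Measure Ω} {X : Ω → ℝ} {c : ℝ≥0}

lemma lintegral_exp_sub_le_one (h : HasSubgaussianMGF X c P) (l : ℝ) :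
    ∫⁻ ω, ENNReal.ofReal (Real.exp (l * X ω - c * l ^ 2 / 2)) ∂P ≤ 1 := by
  simp_rw [sub_eq_neg_add, Real.exp_add, ENNReal.ofReal_mul (Real.exp_nonneg _)]
  rw [lintegral_const_mul' _ _ ENNReal.ofReal_ne_top,
    ← ofReal_integral_eq_lintegral_ofReal (h.integrable_exp_mul l)
      (ae_of_all _ fun _ => Real.exp_nonneg _),
    ← ENNReal.ofReal_mul (Real.exp_nonneg _), ENNReal.ofReal_le_one]
  calc Real.exp (-(c * l ^ 2 / 2)) * mgf X P l
      ≤ Real.exp (-(c * l ^ 2 / 2)) * Real.exp (c * l ^ 2 / 2) := by gcongr; exact h.mgf_le l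
    _ = 1 := by rw [← Real.exp_add, neg_add_cancel, Real.exp_zero]

lemma hasSubgaussianMGF_of_lintegral_le (hX : Measurable X)
    (h : ∀ l : ℝ, ∫⁻ ω, ENNReal.ofReal (Real.exp (l * X ω)) ∂P ≤
      ENNReal.ofReal (Real.exp (c * l ^ 2 / 2))) : HasSubgaussianMGF X c P := by
  have hexp (l : ℝ) : AEStronglyMeasurable (fun ω => Real.exp (l * X ω)) P := by fun_prop
  have hnonneg (l : ℝ) : 0 ≤ᵐ[P] fun ω => Real.exp (l * X ω) :=
    ae_of_all _ fun _ => Real.exp_nonneg _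
  refine ⟨fun l => ⟨hexp l, ?_⟩, fun l => ?_⟩
  · exact (hasFiniteIntegral_iff_ofReal (hnonneg l)).2 ((h l).trans_lt ENNReal.ofReal_lt_top)
  · rw [mgf, integral_eq_lintegral_of_nonneg_ae (hnonneg l) (hexp l)]
    exact ENNReal.toReal_le_of_le_ofReal (Real.exp_nonneg _) (h l)

lemma measureReal_sqrt_le_le (h : HasSubgaussianMGF X c P) (hc : c ≠ 0) {x : ℝ} (hx : 0 ≤ x) :
    P.real {ω | √(2 * x * c) ≤ X ω} ≤ Real.exp (-x) := by
  refine (h.measure_ge_le (Real.sqrt_nonneg _)).trans_eq ?_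
  rw [Real.sq_sqrt (by positivity)]
  congr 1
  field

lemma measureReal_sqrt_le_abs_le [IsFiniteMeasure P] (h : HasSubgaussianMGF X c P) (hc : c ≠ 0)
    {x : ℝ} (hx : 0 ≤ x) :
    P.real {ω | √(2 * x * c) ≤ |X ω|} ≤ 2 * Real.exp (-x) := by
  calc P.real {ω | √(2 * x * c) ≤ |X ω|}
      ≤ P.real ({ω | √(2 * x * c) ≤ X ω} ∪ {ω | √(2 * x * c) ≤ (-X) ω}) :=
        measureReal_mono fun ω (hω : _ ≤ |X ω|) => le_abs.1 hω
    _ ≤ Real.exp (-x) + Real.exp (-x) := (measureReal_union_le _ _).trans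
        (add_le_add (measureReal_sqrt_le_le h hc hx) (measureReal_sqrt_le_le h.neg hc hx))
    _ = 2 * Real.exp (-x) := (two_mul _).symm

end SubGaussian

lemma sum_ite_mul_sub_eq_truncSum {Ω : Type*} {K : ℕ} {A : ℕ → Ω → Fin K} {R : ℕ → Ω → ℝ}
    {k : Fin K} (l m c : ℝ) (s t : ℕ) (ω : Ω) :
    ∑ i ∈ Finset.range t, (if A i ω = k ∧ pullCount A k i ω < s then l * (R i ω - m) - c else 0) =
      l * truncSum A R m k s t ω - (min (pullCount A k t ω) s : ℕ) * c := by
  have hcount : (Finset.filter (fun i => A i ω = k ∧ pullCount A k i ω < s) (Finset.range t)).card =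
      min (pullCount A k t ω) s := by
    rw [pullCount, ← count_and_count_lt, Nat.count_eq_card_filter_range]
    rfl
  rw [truncSum, ← Finset.sum_filter, ← Finset.sum_filter, Finset.sum_sub_distrib, Finset.mul_sum,
    Finset.sum_const, nsmul_eq_mul, hcount]

section Concentration

variable {Ω : Type*} [MeasurableSpace Ω] {K : ℕ} {π : Policy K} {ν : Kernel (Fin K) ℝ}
  [IsMarkovKernel ν] {P : Measure Ω} [IsProbabilityMeasure P] {A : ℕ → Ω → Fin K}
  {R : ℕ → Ω → ℝ} {k : Fin K}

lemma IsRun.lintegral_mul_ite_le (hrun : IsRun π ν P A R) {f : ℝ → ℝ≥0∞} (hf : Measurable f)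
    (hf1 : ∫⁻ x, f x ∂ν k ≤ 1) {t : ℕ} {B : Set Ω} [DecidablePred (· ∈ B)]
    (hB : MeasurableSet[past A R t] B) {g : Ω → ℝ≥0∞} (hg : Measurable[past A R t] g) :
    ∫⁻ ω, g ω * (if A t ω = k ∧ ω ∈ B then f (R t ω) else 1) ∂P ≤ ∫⁻ ω, g ω ∂P := by
  have hBm := hrun.past_le t _ hB
  have hS : MeasurableSet (B ∩ {ω | A t ω = k}) := hBm.inter (hrun.measurableSet_arm t k)
  have hrestrict (φ : Ω → ℝ≥0∞) : ∫⁻ ω in B ∩ {ω | A t ω = k}, φ ω ∂P =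
      ∫⁻ ω in {ω | A t ω = k}, B.indicator φ ω ∂P := by
    rw [lintegral_indicator hBm, Measure.restrict_restrict hBm]
  rw [← lintegral_add_compl _ hS, ← lintegral_add_compl (fun ω => g ω) hS]
  refine add_le_add ?_ (setLIntegral_mono' hS.compl fun ω hω => ?_)
  · calc ∫⁻ ω in B ∩ {ω | A t ω = k}, g ω * (if A t ω = k ∧ ω ∈ B then f (R t ω) else 1) ∂P
        = ∫⁻ ω in {ω | A t ω = k}, B.indicator g ω * f (R t ω) ∂P := by
          rw [hrestrict]
          refine setLIntegral_congr_fun (hrun.measurableSet_arm t k) fun ω (hω : A t ω = k) => ?_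
          by_cases h : ω ∈ B <;> simp [h, hω]
      _ ≤ (∫⁻ ω in {ω | A t ω = k}, B.indicator g ω ∂P) * 1 := by
          rw [hrun.setLIntegral_reward t k (hg.indicator hB) hf]
          gcongr
      _ = ∫⁻ ω in B ∩ {ω | A t ω = k}, g ω ∂P := by rw [mul_one, hrestrict]
  · rw [if_neg fun h => hω ⟨h.2, h.1⟩, mul_one]

/-- Optional skipping: each selected reward multiplies the expectation by at most `1`. -/
lemma IsRun.lintegral_prod_ite_le_one (hrun : IsRun π ν P A R) {f : ℝ → ℝ≥0∞} (hf : Measurable f)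
    (hf1 : ∫⁻ x, f x ∂ν k ≤ 1) {B : ℕ → Set Ω} [∀ i, DecidablePred (· ∈ B i)]
    (hB : ∀ i, MeasurableSet[past A R i] (B i)) (t : ℕ) :
    ∫⁻ ω, ∏ i ∈ Finset.range t, (if A i ω = k ∧ ω ∈ B i then f (R i ω) else 1) ∂P ≤ 1 := by
  induction t with
  | zero => simp
  | succ t ih =>
    simp_rw [Finset.prod_range_succ]
    refine (hrun.lintegral_mul_ite_le hf hf1 (hB t) ?_).trans ih
    refine Finset.measurable_fun_prod _ fun i hi => ?_
    have hi := Finset.mem_range.1 hi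
    exact Measurable.ite ((measurableSet_arm_past hi k).inter (past_mono hi.le _ (hB i)))
      (hf.comp (measurable_reward_past hi)) measurable_const

lemma IsRun.hasSubgaussianMGF_truncSum (hrun : IsRun π ν P A R) {m : ℝ} {v : ℝ≥0}
    (hk : HasSubgaussianMGF (fun x => x - m) v (ν k)) (s t : ℕ) :
    HasSubgaussianMGF (truncSum A R m k s t) (s * v) P := by
  refine hasSubgaussianMGF_of_lintegral_le
    ((measurable_truncSum_past m k s t).mono (hrun.past_le t) le_rfl) fun l => ?_
  set f : ℝ → ℝ≥0∞ := fun x => ENNReal.ofReal (Real.exp (l * (x - m) - v * l ^ 2 / 2)) with hf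
  set B : ℕ → Set Ω := fun i => {ω | pullCount A k i ω < s}
  have hB (i : ℕ) : MeasurableSet[past A R i] (B i) :=
    measurable_pullCount_past i k (measurableSet_Iio (a := s))
  have hprod (ω : Ω) : ENNReal.ofReal (Real.exp (l * truncSum A R m k s t ω)) ≤
      ENNReal.ofReal (Real.exp ((s * v : ℝ≥0) * l ^ 2 / 2)) *
        ∏ i ∈ Finset.range t, (if A i ω = k ∧ ω ∈ B i then f (R i ω) else 1) := by
    have hexp : ∏ i ∈ Finset.range t, (if A i ω = k ∧ ω ∈ B i then f (R i ω) else 1) =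
        ENNReal.ofReal (Real.exp (l * truncSum A R m k s t ω -
          (min (pullCount A k t ω) s : ℕ) * (v * l ^ 2 / 2))) := by
      rw [← sum_ite_mul_sub_eq_truncSum, Real.exp_sum,
        ENNReal.ofReal_prod_of_nonneg fun _ _ => Real.exp_nonneg _]
      refine Finset.prod_congr rfl fun i _ => ?_
      simp only [B, Set.mem_ofPred_eq, hf]
      split_ifs <;> simp
    rw [hexp, ← ENNReal.ofReal_mul (Real.exp_nonneg _), ← Real.exp_add]
    gcongr
    have hmin : ((min (pullCount A k t ω) s : ℕ) : ℝ) * (v * l ^ 2 / 2) ≤ s * (v * l ^ 2 / 2) := by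
      gcongr
      exact min_le_right _ _
    push_cast at hmin ⊢
    linarith
  calc _ ≤ ENNReal.ofReal (Real.exp ((s * v : ℝ≥0) * l ^ 2 / 2)) *
        ∫⁻ ω, ∏ i ∈ Finset.range t, (if A i ω = k ∧ ω ∈ B i then f (R i ω) else 1) ∂P := by
        rw [← lintegral_const_mul' _ _ ENNReal.ofReal_ne_top]
        exact lintegral_mono hprod
    _ ≤ _ := mul_le_of_le_one_right' (hrun.lintegral_prod_ite_le_one (by fun_prop)
        (lintegral_exp_sub_le_one hk l) hB t)

/-- A union bound over the number of pulls instead of over the rounds. -/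
lemma IsRun.measureReal_exists_deviation_le (hrun : IsRun π ν P A R) {m : ℝ} {v : ℝ≥0} (hv : v ≠ 0)
    (hk : HasSubgaussianMGF (fun x => x - m) v (ν k)) {x : ℝ} (hx : 0 ≤ x) (J t : ℕ) :
    P.real {ω | ∃ i ≤ t, pullCount A k i ω ≠ 0 ∧ pullCount A k i ω ≤ J ∧
      √(2 * x * v / pullCount A k i ω) ≤ |empMean (history A R i ω) k - m|} ≤
      2 * J * Real.exp (-x) := by
  set D : ℕ → Set Ω := fun s => {ω | √(2 * x * (s * v : ℝ≥0)) ≤ |truncSum A R m k s t ω|}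
  have hsub : {ω | ∃ i ≤ t, pullCount A k i ω ≠ 0 ∧ pullCount A k i ω ≤ J ∧
      √(2 * x * v / pullCount A k i ω) ≤ |empMean (history A R i ω) k - m|} ⊆
      ⋃ s ∈ Finset.Icc 1 J, D s := by
    rintro ω ⟨i, hit, h0, hJ, hdev⟩
    refine Set.mem_biUnion (Finset.mem_Icc.2 ⟨Nat.pos_of_ne_zero h0, hJ⟩) ?_
    have hn : (0 : ℝ) < pullCount A k i ω := by exact_mod_cast Nat.pos_of_ne_zero h0
    simp only [D, Set.mem_ofPred_eq, truncSum_pullCount m hit h0, abs_mul, abs_of_pos hn]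
    refine le_trans (le_of_eq ?_) (mul_le_mul_of_nonneg_left hdev hn.le)
    rw [← Real.sqrt_sq hn.le, ← Real.sqrt_mul (sq_nonneg _), Real.sqrt_sq hn.le]
    congr 1
    push_cast
    field
  calc _ ≤ ∑ s ∈ Finset.Icc 1 J, P.real (D s) :=
        (measureReal_mono hsub (measure_ne_top _ _)).trans (measureReal_biUnion_finset_le _ _)
    _ ≤ ∑ s ∈ Finset.Icc 1 J, 2 * Real.exp (-x) := by
        refine Finset.sum_le_sum fun s hs => measureReal_sqrt_le_abs_le
          (hrun.hasSubgaussianMGF_truncSum hk s t) (mul_ne_zero ?_ hv) hx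
        exact_mod_cast Nat.one_le_iff_ne_zero.1 (Finset.mem_Icc.1 hs).1
    _ = 2 * J * Real.exp (-x) := by
        rw [Finset.sum_const, Nat.card_Icc, add_tsub_cancel_right, nsmul_eq_mul]
        ring

end Concentration

/-! ### Gaussian tails -/

lemma hasSubgaussianMGF_gaussianReal (m : ℝ) (v : ℝ≥0) :
    HasSubgaussianMGF (fun x => x - m) v (gaussianReal m v) := by
  have hcentered : (gaussianReal m v).map (fun x => x - m) = gaussianReal 0 v := by
    rw [gaussianReal_map_sub_const, sub_self]
  have hid : HasSubgaussianMGF id v (gaussianReal 0 v) :=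
    ⟨integrable_exp_mul_gaussianReal, fun l => by simp [mgf_id_gaussianReal]⟩
  exact HasSubgaussianMGF.of_map (by fun_prop) (hcentered ▸ hid)

lemma gaussianReal_Ici_add_sqrt_le (m : ℝ) {v : ℝ≥0} (hv : v ≠ 0) {x : ℝ} (hx : 0 ≤ x) :
    (gaussianReal m v).real (Set.Ici (m + √(2 * x * v))) ≤ Real.exp (-x) := by
  simpa only [le_sub_iff_add_le', Set.Ici_def] using
    measureReal_sqrt_le_le (hasSubgaussianMGF_gaussianReal m v) hv hx

lemma gaussianReal_Iic_sub_sqrt_le (m : ℝ) {v : ℝ≥0} (hv : v ≠ 0) {x : ℝ} (hx : 0 ≤ x) :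
    (gaussianReal m v).real (Set.Iic (m - √(2 * x * v))) ≤ Real.exp (-x) := by
  have h := measureReal_sqrt_le_le (hasSubgaussianMGF_gaussianReal m v).neg hv hx
  simpa only [Pi.neg_apply, neg_sub, le_sub_comm, Set.Iic_def] using h

/-- The density is at least its value at `z + 1` standard deviations on an interval whose length is
one standard deviation. -/
lemma le_gaussianReal_Ici (m : ℝ) {v : ℝ≥0} (hv : v ≠ 0) {z : ℝ} (hz : 0 ≤ z) :
    (√(2 * Real.pi))⁻¹ * Real.exp (-(z + 1) ^ 2 / 2) ≤
      (gaussianReal m v).real (Set.Ici (m + z * √v)) := by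
  have hv0 : (0 : ℝ) < v := by exact_mod_cast pos_iff_ne_zero.2 hv
  have hs0 : 0 < √(v : ℝ) := Real.sqrt_pos.2 hv0
  set I := Set.Icc (m + z * √(v : ℝ)) (m + (z + 1) * √(v : ℝ)) with hI
  have hvol : volume.real I = √(v : ℝ) := by
    rw [hI, Real.volume_real_Icc_of_le (by gcongr; linarith)]
    ring
  have hdensity (x : ℝ) (hx : x ∈ I) :
      (√(2 * Real.pi * v))⁻¹ * Real.exp (-(z + 1) ^ 2 / 2) ≤ gaussianPDFReal m v x := by
    have hsq : (x - m) ^ 2 ≤ (z + 1) ^ 2 * v := by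
      rw [← Real.sq_sqrt hv0.le, ← mul_pow]
      exact pow_le_pow_left₀ (by nlinarith [hx.1]) (by linarith [hx.2]) 2
    rw [gaussianPDFReal]
    refine mul_le_mul_of_nonneg_left (Real.exp_le_exp.2 ?_) (by positivity)
    rw [div_le_div_iff₀ two_pos (by positivity)]
    linarith
  calc (√(2 * Real.pi))⁻¹ * Real.exp (-(z + 1) ^ 2 / 2)
      = (√(2 * Real.pi * v))⁻¹ * Real.exp (-(z + 1) ^ 2 / 2) * volume.real I := by
        rw [hvol, Real.sqrt_mul (by positivity) (v : ℝ)]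
        field
    _ ≤ ∫ x in I, gaussianPDFReal m v x :=
        setIntegral_ge_of_const_le_real measurableSet_Icc (by rw [hI, Real.volume_Icc]; simp)
          hdensity (integrable_gaussianPDFReal m v).integrableOn
    _ = (gaussianReal m v).real I := by
        rw [measureReal_def, gaussianReal_apply_eq_integral m hv,
          ENNReal.toReal_ofReal (integral_nonneg fun x => gaussianPDFReal_nonneg m v x)]
    _ ≤ (gaussianReal m v).real (Set.Ici (m + z * √v)) := measureReal_mono fun x hx => hx.1

/-! ### Comparing the pulls of two arms -/

/-- A potential that grows with the pulls of arm `l` in the rounds of `B` and is halved by every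
pull of arm `k`. Its expectation grows slowly if the policy pulls `l` in the rounds of `B` at most
about as often as `k`. -/
noncomputable def potential {Ω : Type*} {K : ℕ} (A : ℕ → Ω → Fin K) (B : ℕ → Set Ω)
    [∀ i, DecidablePred (· ∈ B i)] (k l : Fin K) (q : ℝ≥0) (t : ℕ) (ω : Ω) : ℝ≥0∞ :=
  (1 + q) ^ Nat.count (fun i => A i ω = l ∧ ω ∈ B i) t * 2⁻¹ ^ pullCount A k t ω

section Potential

variable {Ω : Type*} {K : ℕ} {A : ℕ → Ω → Fin K} {R : ℕ → Ω → ℝ} {B : ℕ → Set Ω}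
  [∀ i, DecidablePred (· ∈ B i)] {k l : Fin K} {q : ℝ≥0}

lemma potential_succ_add (hne : l ≠ k) (t : ℕ) (ω : Ω) :
    potential A B k l q (t + 1) ω +
        {ω | A t ω = k}.indicator (fun ω => 2⁻¹ * potential A B k l q t ω) ω =
      potential A B k l q t ω +
        {ω | A t ω = l}.indicator ((B t).indicator fun ω => q * potential A B k l q t ω) ω := by
  simp only [potential, pullCount, Nat.count_succ, Set.indicator_apply, Set.mem_ofPred_eq]
  by_cases hk : A t ω = k
  · have hl : k ≠ l := hne.symm
    simp only [hk, hl, if_true, if_false, false_and, add_zero, pow_succ']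
    rw [mul_left_comm, ← add_mul, ENNReal.inv_two_add_inv_two, one_mul]
  · by_cases hl : A t ω = l <;> by_cases hB : ω ∈ B t <;> simp [hl, hB, hne, hk]
    ring

lemma measurable_potential_past (hB : ∀ i, MeasurableSet[past A R i] (B i)) (t : ℕ) :
    Measurable[past A R t] (potential A B k l q t) := by
  have hcount : Measurable[past A R t] fun ω => Nat.count (fun i => A i ω = l ∧ ω ∈ B i) t :=
    measurable_count fun i hi => (measurableSet_arm_past hi l).inter (past_mono hi.le _ (hB i))
  exact ((measurable_from_top (f := fun n : ℕ => (1 + q : ℝ≥0∞) ^ n)).comp hcount).mul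
    ((measurable_from_top (f := fun n : ℕ => (2⁻¹ : ℝ≥0∞) ^ n)).comp
      (measurable_pullCount_past t k))

variable [MeasurableSpace Ω] {π : Policy K} [∀ t, IsMarkovKernel (π t)] {ν : Kernel (Fin K) ℝ}
  {P : Measure Ω} [IsProbabilityMeasure P] {η : ℝ≥0}

lemma IsRun.lintegral_potential_succ_le (hrun : IsRun π ν P A R) (hne : l ≠ k)
    (hB : ∀ i, MeasurableSet[past A R i] (B i)) {t : ℕ}
    (h : ∀ ω ∈ B t, q * π t (history A R t ω) {l} ≤ η + 2⁻¹ * π t (history A R t ω) {k})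
    (hfin : ∫⁻ ω, potential A B k l q t ω ∂P ≠ ∞) :
    ∫⁻ ω, potential A B k l q (t + 1) ω ∂P ≤ (1 + η) * ∫⁻ ω, potential A B k l q t ω ∂P := by
  have hΦpast := measurable_potential_past (k := k) (l := l) (q := q) hB t
  set Φ := potential A B k l q t
  have hΦ : Measurable Φ := hΦpast.mono (hrun.past_le t) le_rfl
  have hbal : ∫⁻ ω, potential A B k l q (t + 1) ω ∂P +
        ∫⁻ ω, 2⁻¹ * Φ ω * π t (history A R t ω) {k} ∂P =
      ∫⁻ ω, Φ ω ∂P +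
        ∫⁻ ω, (B t).indicator (fun ω => q * Φ ω) ω * π t (history A R t ω) {l} ∂P := by
    rw [← hrun.setLIntegral_arm t k (hΦpast.const_mul _),
      ← hrun.setLIntegral_arm t l ((hΦpast.const_mul _).indicator (hB t)),
      ← lintegral_indicator (hrun.measurableSet_arm t k),
      ← lintegral_indicator (hrun.measurableSet_arm t l), ← lintegral_add_left hΦ,
      ← lintegral_add_right _ ((hΦ.const_mul _).indicator (hrun.measurableSet_arm t k))]
    exact lintegral_congr (potential_succ_add hne t)
  have hgain : ∫⁻ ω, (B t).indicator (fun ω => q * Φ ω) ω * π t (history A R t ω) {l} ∂P ≤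
      η * ∫⁻ ω, Φ ω ∂P + ∫⁻ ω, 2⁻¹ * Φ ω * π t (history A R t ω) {k} ∂P := by
    rw [← lintegral_const_mul _ hΦ, ← lintegral_add_left (hΦ.const_mul _)]
    refine lintegral_mono fun ω => ?_
    by_cases hω : ω ∈ B t
    · rw [Set.indicator_of_mem hω]
      calc q * Φ ω * π t (history A R t ω) {l}
          = Φ ω * (q * π t (history A R t ω) {l}) := by ring
        _ ≤ Φ ω * (η + 2⁻¹ * π t (history A R t ω) {k}) := by gcongr; exact h ω hω
        _ = η * Φ ω + 2⁻¹ * Φ ω * π t (history A R t ω) {k} := by ring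
    · simp [hω]
  have hloss : ∫⁻ ω, 2⁻¹ * Φ ω * π t (history A R t ω) {k} ∂P ≠ ∞ := by
    refine ne_top_of_le_ne_top hfin (lintegral_mono fun ω => ?_)
    refine (mul_le_of_le_one_right' prob_le_one).trans (mul_le_of_le_one_left' ?_)
    exact ENNReal.inv_le_one.2 one_le_two
  refine (ENNReal.add_le_add_iff_right hloss).1 ?_
  rw [hbal, add_mul, one_mul, add_assoc]
  gcongr

lemma IsRun.lintegral_potential_le (hrun : IsRun π ν P A R) (hne : l ≠ k)
    (hB : ∀ i, MeasurableSet[past A R i] (B i)) {t : ℕ}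
    (h : ∀ i < t, ∀ ω ∈ B i, q * π i (history A R i ω) {l} ≤
      η + 2⁻¹ * π i (history A R i ω) {k}) :
    ∫⁻ ω, potential A B k l q t ω ∂P ≤ (1 + η) ^ t := by
  induction t with
  | zero => simp [potential, pullCount]
  | succ t ih =>
    have ih := ih fun i hi => h i (hi.trans t.lt_succ_self)
    calc ∫⁻ ω, potential A B k l q (t + 1) ω ∂P
        ≤ (1 + η) * ∫⁻ ω, potential A B k l q t ω ∂P :=
          hrun.lintegral_potential_succ_le hne hB (h t t.lt_succ_self)
            (ne_top_of_le_ne_top (ENNReal.pow_ne_top (by simp)) ih)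
      _ ≤ (1 + η) * (1 + η) ^ t := by gcongr
      _ = (1 + η) ^ (t + 1) := (pow_succ' _ _).symm

lemma IsRun.measureReal_le_count_pullCount_le_le (hrun : IsRun π ν P A R) (hne : l ≠ k)
    (hB : ∀ i, MeasurableSet[past A R i] (B i)) {t : ℕ}
    (h : ∀ i < t, ∀ ω ∈ B i, q * (π i (history A R i ω)).real {l} ≤
      η + 2⁻¹ * (π i (history A R i ω)).real {k}) (J N : ℕ) :
    P.real {ω | N ≤ Nat.count (fun i => A i ω = l ∧ ω ∈ B i) t ∧ pullCount A k t ω ≤ J} ≤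
      (1 + η) ^ t * 2 ^ J / (1 + q) ^ N := by
  have h' (i : ℕ) (hi : i < t) (ω : Ω) (hω : ω ∈ B i) :
      q * π i (history A R i ω) {l} ≤ η + 2⁻¹ * π i (history A R i ω) {k} := by
    refine (ENNReal.toReal_le_toReal (by finiteness) (by finiteness)).1 ?_
    simpa [ENNReal.toReal_add, ENNReal.mul_eq_top, measureReal_def] using h i hi ω hω
  set c : ℝ≥0 := (1 + q) ^ N * 2⁻¹ ^ J with hc
  have hc0 : c ≠ 0 := by positivity
  have hmarkov : P {ω | (c : ℝ≥0∞) ≤ potential A B k l q t ω} ≤ ((1 + η) ^ t / c : ℝ≥0) := by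
    rw [ENNReal.coe_div hc0]
    push_cast
    refine (meas_ge_le_lintegral_div ?_ (by simpa using hc0) ENNReal.coe_ne_top).trans ?_
    · exact ((measurable_potential_past hB t).mono (hrun.past_le t) le_rfl).aemeasurable
    · gcongr
      exact hrun.lintegral_potential_le hne hB h'
  have hsub : {ω | N ≤ Nat.count (fun i => A i ω = l ∧ ω ∈ B i) t ∧ pullCount A k t ω ≤ J} ⊆
      {ω | (c : ℝ≥0∞) ≤ potential A B k l q t ω} := by
    rintro ω ⟨hN, hJ⟩
    simp only [hc, Set.mem_ofPred_eq]
    push_cast [ENNReal.coe_inv two_ne_zero]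
    exact mul_le_mul' (pow_le_pow_right₀ (by simp) hN)
      (pow_le_pow_right_of_le_one' (ENNReal.inv_le_one.2 one_le_two) hJ)
  refine (ENNReal.toReal_mono ENNReal.coe_ne_top ((measure_mono hsub).trans hmarkov)).trans_eq ?_
  rw [ENNReal.coe_toReal, hc]
  push_cast
  rw [inv_pow, ← div_eq_mul_inv, div_div_eq_mul_div]

end Potential

/-! ### Events with summable probabilities -/

/-- A run of a policy of the class `Q` in the bandit model, together with the probability space on
which it is defined. Constants that are uniform over all runs are stated with this index type. -/
structure BanditRun.{u} {K : ℕ} {Θ : Type*} (μ : Fin K → Θ → ℝ) (θstar : Θ) (σ : ℝ≥0)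
    (Q : Policy K → Prop) where
  Ω : Type u
  measurableSpace : MeasurableSpace Ω
  P : Measure Ω
  π : Policy K
  ν : Kernel (Fin K) ℝ
  A : ℕ → Ω → Fin K
  R : ℕ → Ω → ℝ
  isProbabilityMeasure : IsProbabilityMeasure P
  isMarkovKernel_policy : ∀ t, IsMarkovKernel (π t)
  isMarkovKernel_reward : IsMarkovKernel ν
  isRewardLaw : IsRewardLaw μ θstar σ ν
  policy_mem : Q π
  isRun : IsRun π ν P A R

attribute [instance] BanditRun.measurableSpace BanditRun.isProbabilityMeasure
  BanditRun.isMarkovKernel_policy BanditRun.isMarkovKernel_reward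

/-- The probabilities of the events `E i t` are bounded by a sequence that is summable over `t` and
does not depend on `i`. -/
def SummablyRare {ι : Type*} {Ω : ι → Type*} [∀ i, MeasurableSpace (Ω i)]
    (P : ∀ i, Measure (Ω i)) (E : ∀ i, ℕ → Set (Ω i)) : Prop :=
  ∃ f : ℕ → ℝ, Summable f ∧ (∀ t, 0 ≤ f t) ∧ ∀ i t, (P i).real (E i t) ≤ f t

section SummablyRare

variable {ι : Type*} {Ω : ι → Type*} [∀ i, MeasurableSpace (Ω i)] {P : ∀ i, Measure (Ω i)}
  {E E' : ∀ i, ℕ → Set (Ω i)}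

lemma SummablyRare.union (hE : SummablyRare P E) (hE' : SummablyRare P E') :
    SummablyRare P fun i t => E i t ∪ E' i t := by
  obtain ⟨f, hf, hf0, hfE⟩ := hE
  obtain ⟨f', hf', hf0', hfE'⟩ := hE'
  exact ⟨fun t => f t + f' t, hf.add hf', fun t => add_nonneg (hf0 t) (hf0' t),
    fun i t => (measureReal_union_le _ _).trans (add_le_add (hfE i t) (hfE' i t))⟩

lemma SummablyRare.iUnion {κ : Type*} [Finite κ] {E : κ → ∀ i, ℕ → Set (Ω i)}
    (hE : ∀ k, SummablyRare P (E k)) : SummablyRare P fun i t => ⋃ k, E k i t := by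
  have := Fintype.ofFinite κ
  choose f hf hf0 hfE using hE
  exact ⟨fun t => ∑ k, f k t, summable_sum fun k _ => hf k,
    fun t => Finset.sum_nonneg fun k _ => hf0 k t, fun i t =>
      (measureReal_iUnion_fintype_le _).trans (Finset.sum_le_sum fun k _ => hfE k i t)⟩

variable [∀ i, IsProbabilityMeasure (P i)]

lemma SummablyRare.of_eventually_le {f : ℕ → ℝ} (hf : Summable f)
    (h : ∀ᶠ t in atTop, ∀ i, (P i).real (E i t) ≤ f t) : SummablyRare P E := by
  obtain ⟨t₀, ht₀⟩ := eventually_atTop.1 h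
  refine ⟨fun t => |f t| + if t < t₀ then 1 else 0, hf.abs.add ?_, fun t => by positivity,
    fun i t => ?_⟩
  · exact summable_of_ne_finset_zero (s := Finset.range t₀) fun t ht => by simpa using ht
  · dsimp only
    split_ifs with ht
    · linarith [measureReal_le_one (μ := P i) (s := E i t), abs_nonneg (f t)]
    · rw [add_zero]
      exact (ht₀ t (not_lt.1 ht) i).trans (le_abs_self _)

lemma SummablyRare.mono (hE : SummablyRare P E')
    (h : ∀ᶠ t in atTop, ∀ i, ∀ᵐ ω ∂P i, ω ∈ E i t → ω ∈ E' i t) : SummablyRare P E := by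
  obtain ⟨f, hf, -, hfE⟩ := hE
  refine SummablyRare.of_eventually_le hf ?_
  filter_upwards [h] with t ht i
  exact (ENNReal.toReal_mono (measure_ne_top _ _) (measure_mono_ae (ht i))).trans (hfE i t)

end SummablyRare

/-! ### From the number of pulls to the regret -/

lemma competitive_of_forall_le {K : ℕ} {Θ : Type*} {μ : Fin K → Θ → ℝ} {θstar : Θ}
    {kstar : Fin K} (hopt : ∀ k, μ k θstar ≤ μ kstar θstar) : Competitive μ kstar θstar kstar :=
  fun ε hε => ⟨θstar, by simpa [levelNbhd] using hε, hopt⟩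

lemma monotone_log_natCast : Monotone fun n : ℕ => Real.log n := by
  intro m n hmn
  rcases m.eq_zero_or_pos with rfl | hm
  · simpa using Real.log_natCast_nonneg n
  · exact Real.log_le_log (by exact_mod_cast hm) (by exact_mod_cast hmn)

section Regret

variable {K : ℕ} {Θ : Type*} {μ : Fin K → Θ → ℝ} {θstar : Θ} {kstar : Fin K} {Ω : Type*}
  [MeasurableSpace Ω] {P : Measure Ω} [IsProbabilityMeasure P] {A : ℕ → Ω → Fin K}

lemma sum_measureReal_le_of_count_le {p : ℕ → Ω → Prop} [∀ t, DecidablePred (p t)]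
    (hp : ∀ t, MeasurableSet {ω | p t ω}) {T : ℕ} {c : ℝ}
    (h : ∀ ω, (Nat.count (p · ω) T : ℝ) ≤ c) :
    ∑ t ∈ Finset.range T, P.real {ω | p t ω} ≤ c := by
  have hintegrable (t : ℕ) : Integrable ({ω | p t ω}.indicator (1 : Ω → ℝ)) P :=
    (integrable_const 1).indicator (hp t)
  calc ∑ t ∈ Finset.range T, P.real {ω | p t ω}
      = ∫ ω, ∑ t ∈ Finset.range T, {ω | p t ω}.indicator (1 : Ω → ℝ) ω ∂P := by
        rw [integral_finsetSum _ fun t _ => hintegrable t]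
        exact Finset.sum_congr rfl fun t _ => (integral_indicator_one (hp t)).symm
    _ ≤ ∫ _, c ∂P := by
        refine integral_mono (integrable_finsetSum _ fun t _ => hintegrable t) (integrable_const c)
          fun ω => le_trans (le_of_eq ?_) (h ω)
        simp [Set.indicator_apply, Nat.count_eq_card_filter_range]
    _ = c := by simp

lemma expRegret_eq_sum (hA : ∀ t, Measurable (A t)) (T : ℕ) :
    expRegret μ kstar θstar P A T =
      ∑ k, (μ kstar θstar - μ k θstar) * ∑ t ∈ Finset.range T, P.real {ω | A t ω = k} := by
  have hm (t : ℕ) (k : Fin K) : MeasurableSet {ω | A t ω = k} := hA t (measurableSet_singleton k)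
  have hsplit (t : ℕ) (ω : Ω) : μ kstar θstar - μ (A t ω) θstar =
      ∑ k, {ω | A t ω = k}.indicator (fun _ => μ kstar θstar - μ k θstar) ω := by
    simp [Set.indicator_apply]
  have hintegrable (t : ℕ) (k : Fin K) :
      Integrable ({ω | A t ω = k}.indicator fun _ => μ kstar θstar - μ k θstar) P :=
    (integrable_const _).indicator (hm t k)
  simp_rw [expRegret, hsplit, Finset.mul_sum]
  rw [integral_finsetSum _ fun t _ => integrable_finsetSum _ fun k _ => hintegrable t k,
    Finset.sum_comm]
  refine Finset.sum_congr rfl fun t _ => ?_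
  rw [integral_finsetSum _ fun k _ => hintegrable t k]
  exact Finset.sum_congr rfl fun k _ => by
    rw [integral_indicator_const _ (hm t k), smul_eq_mul, mul_comm]

lemma sum_measureReal_arm_le (hA : ∀ t, Measurable (A t)) (k : Fin K) {L : ℝ} (hL : 0 ≤ L)
    {f : ℕ → ℝ} (hf : Summable f) (hf0 : ∀ t, 0 ≤ f t)
    (hk : ∀ t, P.real {ω | A t ω = k ∧ L * Real.log t ≤ pullCount A k t ω} ≤ f t) (T : ℕ) :
    ∑ t ∈ Finset.range T, P.real {ω | A t ω = k} ≤ L * Real.log T + 1 + ∑' t, f t := by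
  have hx : 0 ≤ L * Real.log T := mul_nonneg hL (Real.log_natCast_nonneg T)
  have hfew : ∑ t ∈ Finset.range T,
      P.real {ω | A t ω = k ∧ (pullCount A k t ω : ℝ) < L * Real.log T} ≤ L * Real.log T + 1 := by
    refine sum_measureReal_le_of_count_le (fun t => ?_) fun ω => count_and_count_lt_le _ hx T
    have hcount : Measurable (pullCount A k t) :=
      measurable_count fun i _ => hA i (measurableSet_singleton k)
    exact (hA t (measurableSet_singleton k)).inter
      (hcount (MeasurableSet.of_discrete (s := {n : ℕ | (n : ℝ) < L * Real.log T})))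
  have hsplit (t : ℕ) (ht : t ∈ Finset.range T) : P.real {ω | A t ω = k} ≤
      P.real {ω | A t ω = k ∧ (pullCount A k t ω : ℝ) < L * Real.log T} + f t := by
    have hlog : L * Real.log t ≤ L * Real.log T :=
      mul_le_mul_of_nonneg_left (monotone_log_natCast (Finset.mem_range.1 ht).le) hL
    refine le_trans (measureReal_mono (fun ω hω => ?_) (measure_ne_top _ _))
      ((measureReal_union_le _ _).trans (add_le_add le_rfl (hk t)))
    exact (lt_or_ge (pullCount A k t ω : ℝ) (L * Real.log T)).imp (⟨hω, ·⟩) (⟨hω, hlog.trans ·⟩)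
  calc _ ≤ _ := Finset.sum_le_sum hsplit
    _ ≤ _ := by
      rw [Finset.sum_add_distrib]
      exact add_le_add hfew (hf.sum_le_tsum _ fun t _ => hf0 t)

lemma expRegret_le (hopt : ∀ k, μ k θstar ≤ μ kstar θstar) (hA : ∀ t, Measurable (A t)) {T : ℕ}
    {a b : ℝ} (ha0 : 0 ≤ a)
    (ha : ∀ k, μ k θstar < μ kstar θstar →
      ∑ t ∈ Finset.range T, P.real {ω | A t ω = k} ≤ a)
    (hb : ∀ k, ¬ Competitive μ kstar θstar k →
      ∑ t ∈ Finset.range T, P.real {ω | A t ω = k} ≤ b) :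
    expRegret μ kstar θstar P A T ≤
      ((numCompetitive μ kstar θstar : ℝ) - 1) * ((∑ k, (μ kstar θstar - μ k θstar)) * a) +
      (K - (numCompetitive μ kstar θstar : ℝ)) * ((∑ k, (μ kstar θstar - μ k θstar)) * b) := by
  classical
  have hgap (k : Fin K) : 0 ≤ μ kstar θstar - μ k θstar := sub_nonneg.2 (hopt k)
  set D := ∑ k, (μ kstar θstar - μ k θstar)
  have hgapD (k : Fin K) : μ kstar θstar - μ k θstar ≤ D :=
    Finset.single_le_sum (fun j _ => hgap j) (Finset.mem_univ k)
  have hD0 : 0 ≤ D := (hgap kstar).trans (hgapD kstar)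
  have hpulls (k : Fin K) : 0 ≤ ∑ t ∈ Finset.range T, P.real {ω | A t ω = k} :=
    Finset.sum_nonneg fun t _ => measureReal_nonneg
  set C : Finset (Fin K) := {k | Competitive μ kstar θstar k}
  have hcard : (C.card : ℝ) = numCompetitive μ kstar θstar := by
    simp [C, numCompetitive, ← Set.ncard_coe_finset]
  have hstar : kstar ∈ C := by simpa [C] using competitive_of_forall_le hopt
  have hcomp (k : Fin K) : (μ kstar θstar - μ k θstar) *
      ∑ t ∈ Finset.range T, P.real {ω | A t ω = k} ≤ D * a := by
    rcases (hopt k).eq_or_lt with heq | hlt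
    · rw [heq, sub_self, zero_mul]
      exact mul_nonneg hD0 ha0
    · exact mul_le_mul (hgapD k) (ha k hlt) (hpulls k) hD0
  have hnoncomp (k : Fin K) (hk : k ∈ Cᶜ) : (μ kstar θstar - μ k θstar) *
      ∑ t ∈ Finset.range T, P.real {ω | A t ω = k} ≤ D * b :=
    mul_le_mul (hgapD k) (hb k (by simpa [C] using hk)) (hpulls k) hD0
  rw [expRegret_eq_sum hA, ← Finset.sum_add_sum_compl C, ← Finset.add_sum_erase C _ hstar,
    sub_self, zero_mul, zero_add]
  refine add_le_add ((Finset.sum_le_card_nsmul _ _ _ fun k _ => hcomp k).trans_eq ?_)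
    ((Finset.sum_le_card_nsmul _ _ _ hnoncomp).trans_eq ?_)
  · rw [nsmul_eq_mul, Finset.cast_card_erase_of_mem hstar, hcard]
  · rw [nsmul_eq_mul, Finset.card_compl, Nat.cast_sub (Finset.card_le_univ C), hcard,
      Fintype.card_fin]

end Regret

/-- The regret bound of the theorem for all policies of the class `Q`: there are constants `c₁` and
`c₂` with `E[Reg(T)] ≤ (C(θ*) - 1) c₁ log T + (K - C(θ*)) c₂`, uniformly over the reward laws, the
policies and the probability spaces of the universe `u`. -/
def HasRegretBound.{u} {K : ℕ} {Θ : Type*} (μ : Fin K → Θ → ℝ) (θstar : Θ) (kstar : Fin K)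
    (σ : ℝ≥0) (Q : Policy K → Prop) : Prop :=
  ∃ c₁ c₂ : ℝ, 0 ≤ c₁ ∧ 0 ≤ c₂ ∧
    ∀ (ν : Kernel (Fin K) ℝ) [IsMarkovKernel ν], IsRewardLaw μ θstar σ ν →
    ∀ (π : Policy K) [∀ t, IsMarkovKernel (π t)], Q π →
    ∀ {Ω : Type u} [MeasurableSpace Ω] (P : Measure Ω) [IsProbabilityMeasure P]
      (A : ℕ → Ω → Fin K) (R : ℕ → Ω → ℝ), IsRun π ν P A R →
      (∀ T : ℕ, 2 ≤ T → expRegret μ kstar θstar P A T ≤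
        ((numCompetitive μ kstar θstar : ℝ) - 1) * (c₁ * Real.log T) +
        ((K : ℝ) - (numCompetitive μ kstar θstar : ℝ)) * c₂) ∧
      (numCompetitive μ kstar θstar = 1 →
        ∀ T : ℕ, expRegret μ kstar θstar P A T ≤ ((K : ℝ) - 1) * c₂)

section HasRegretBound

universe u

variable {K : ℕ} {Θ : Type*} {μ : Fin K → Θ → ℝ} {θstar : Θ} {kstar : Fin K} {σ : ℝ≥0}
  {Q : Policy K → Prop}

lemma hasRegretBound_of_sum_le (hopt : ∀ k, μ k θstar ≤ μ kstar θstar) {L S : ℝ} (hL : 0 ≤ L)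
    (hS : 0 ≤ S)
    (hc : ∀ (r : BanditRun.{u} μ θstar σ Q) (k : Fin K), μ k θstar < μ kstar θstar → ∀ T : ℕ,
      ∑ t ∈ Finset.range T, r.P.real {ω | r.A t ω = k} ≤ L * Real.log T + S)
    (hnc : ∀ (r : BanditRun.{u} μ θstar σ Q) (k : Fin K), ¬ Competitive μ kstar θstar k →
      ∀ T : ℕ, ∑ t ∈ Finset.range T, r.P.real {ω | r.A t ω = k} ≤ S) :
    HasRegretBound.{u} μ θstar kstar σ Q := by
  set D := ∑ k, (μ kstar θstar - μ k θstar)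
  have hD0 : 0 ≤ D := Finset.sum_nonneg fun k _ => sub_nonneg.2 (hopt k)
  have hlog2 : 0 < Real.log 2 := Real.log_pos one_lt_two
  have hC : (1 : ℝ) ≤ numCompetitive μ kstar θstar := by
    exact_mod_cast (Set.ncard_pos (Set.toFinite _)).2 ⟨kstar, competitive_of_forall_le hopt⟩
  refine ⟨D * (L + S / Real.log 2), D * S, by positivity, by positivity,
    fun ν _ hν π _ hπ Ω _ P _ A R hrun => ?_⟩
  set r : BanditRun.{u} μ θstar σ Q := ⟨Ω, ‹_›, P, π, ν, A, R, ‹_›, ‹_›, ‹_›, hν, hπ, hrun⟩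
  have hreg (T : ℕ) := expRegret_le (P := P) hopt hrun.measurable_arm (a := L * Real.log T + S)
    (by positivity) (fun k hk => hc r k hk T) (fun k hk => hnc r k hk T)
  refine ⟨fun T hT => (hreg T).trans ?_, fun h1 T => (hreg T).trans_eq ?_⟩
  · have hST : S ≤ S / Real.log 2 * Real.log T := by
      rw [div_mul_eq_mul_div, le_div_iff₀ hlog2]
      gcongr
      exact_mod_cast hT
    rw [mul_assoc D, add_mul L]
    gcongr
  · rw [h1, Nat.cast_one, sub_self, zero_mul, zero_add]

lemma hasRegretBound_of_summablyRare (hopt : ∀ k, μ k θstar ≤ μ kstar θstar)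
    (hc : ∀ k, μ k θstar < μ kstar θstar → ∃ L : ℝ, 0 ≤ L ∧
      SummablyRare (fun r : BanditRun.{u} μ θstar σ Q => r.P)
        fun r t => {ω | r.A t ω = k ∧ L * Real.log t ≤ pullCount r.A k t ω})
    (hnc : ∀ k, ¬ Competitive μ kstar θstar k →
      SummablyRare (fun r : BanditRun.{u} μ θstar σ Q => r.P) fun r t => {ω | r.A t ω = k}) :
    HasRegretBound.{u} μ θstar kstar σ Q := by
  classical
  choose L hL f hf hf0 hfE using hc
  choose g hg hg0 hgE using hnc
  set L' : ℝ := ∑ k : {k // μ k θstar < μ kstar θstar}, L k k.2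
  set F : ℝ := ∑ k : {k // μ k θstar < μ kstar θstar}, ∑' t, f k k.2 t
  set G : ℝ := ∑ k : {k // ¬ Competitive μ kstar θstar k}, ∑' t, g k k.2 t
  have hF0 : 0 ≤ F := Finset.sum_nonneg fun k _ => tsum_nonneg (hf0 k k.2)
  have hG0 : 0 ≤ G := Finset.sum_nonneg fun k _ => tsum_nonneg (hg0 k k.2)
  refine hasRegretBound_of_sum_le hopt (L := L') (S := 1 + F + G)
    (Finset.sum_nonneg fun k _ => hL k k.2) (by positivity) (fun r k hk T => ?_)
    fun r k hk T => ?_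
  · have hLk : L k hk ≤ L' := Finset.single_le_sum
      (f := fun k : {k // μ k θstar < μ kstar θstar} => L k k.2)
      (fun j _ => hL j j.2) (Finset.mem_univ ⟨k, hk⟩)
    have hfk : ∑' t, f k hk t ≤ F := Finset.single_le_sum
      (f := fun k : {k // μ k θstar < μ kstar θstar} => ∑' t, f k k.2 t)
      (fun j _ => tsum_nonneg (hf0 j j.2)) (Finset.mem_univ ⟨k, hk⟩)
    have hLT := mul_le_mul_of_nonneg_right hLk (Real.log_natCast_nonneg T)
    linarith [sum_measureReal_arm_le r.isRun.measurable_arm k (hL k hk) (hf k hk) (hf0 k hk)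
      (hfE k hk r) T]
  · have hgk : ∑' t, g k hk t ≤ G := Finset.single_le_sum
      (f := fun k : {k // ¬ Competitive μ kstar θstar k} => ∑' t, g k k.2 t)
      (fun j _ => tsum_nonneg (hg0 j j.2)) (Finset.mem_univ ⟨k, hk⟩)
    linarith [Finset.sum_le_sum fun t (_ : t ∈ Finset.range T) => hgE k hk r t,
      (hg k hk).sum_le_tsum (Finset.range T) fun t _ => hg0 k hk t]

end HasRegretBound

/-! ### Growth of logarithms -/

lemma eventually_le_natDiv {f : ℕ → ℝ} (hf : f =o[atTop] fun t : ℕ => (t : ℝ)) {m : ℕ}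
    (hm : m ≠ 0) : ∀ᶠ t : ℕ in atTop, f t ≤ (t / m : ℕ) := by
  have : (0 : ℝ) < m := by exact_mod_cast hm.bot_lt
  filter_upwards [hf.def (c := (2 * m : ℝ)⁻¹) (by positivity), eventually_ge_atTop (2 * m)]
    with t hft ht
  have hdiv : (t : ℝ) < (t / m : ℕ) * m + m := by exact_mod_cast Nat.lt_div_mul_add hm.bot_lt
  have ht' : 2 * (m : ℝ) ≤ t := by exact_mod_cast ht
  calc f t ≤ (2 * m : ℝ)⁻¹ * t := (Real.le_norm_self _).trans (by simpa using hft)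
    _ ≤ (t / m : ℕ) := by
      rw [inv_mul_le_iff₀ (by positivity)]
      linarith

lemma eventually_mul_log_le_natDiv (C : ℝ) {m : ℕ} (hm : m ≠ 0) :
    ∀ᶠ t : ℕ in atTop, C * Real.log t ≤ (t / m : ℕ) :=
  eventually_le_natDiv
    ((Real.isLittleO_log_id_atTop.const_mul_left C).comp_tendsto tendsto_natCast_atTop_atTop) hm

lemma eventually_mul_log_sq_le_natDiv (C : ℝ) {m : ℕ} (hm : m ≠ 0) :
    ∀ᶠ t : ℕ in atTop, C * Real.log t ^ 2 ≤ (t / m : ℕ) :=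
  eventually_le_natDiv
    ((Real.isLittleO_pow_log_id_atTop.const_mul_left C).comp_tendsto tendsto_natCast_atTop_atTop)
    hm

lemma isLittleO_rpow_mul_log_natCast {r : ℝ} (hr : r < 1) :
    (fun t : ℕ => (t : ℝ) ^ r * Real.log t) =o[atTop] fun t : ℕ => (t : ℝ) := by
  have h := ((Asymptotics.isBigO_refl (fun x : ℝ => x ^ r) atTop).mul_isLittleO
    (isLittleO_log_rpow_atTop (sub_pos.2 hr))).comp_tendsto tendsto_natCast_atTop_atTop
  refine h.congr' EventuallyEq.rfl ?_
  filter_upwards [eventually_gt_atTop 0] with t ht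
  simp [← Real.rpow_add (Nat.cast_pos.2 ht)]

lemma isLittleO_rpow_natCast {r : ℝ} (hr : r < 1) :
    (fun t : ℕ => (t : ℝ) ^ r) =o[atTop] fun t : ℕ => (t : ℝ) := by
  refine Asymptotics.IsBigO.trans_isLittleO (Asymptotics.IsBigO.of_bound' ?_)
    (isLittleO_rpow_mul_log_natCast hr)
  filter_upwards [(Real.tendsto_log_atTop.comp tendsto_natCast_atTop_atTop).eventually_ge_atTop 1]
    with t ht
  rw [norm_mul]
  exact le_mul_of_one_le_right (norm_nonneg _) (ht.trans (Real.le_norm_self _))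

lemma eventually_mul_log_le_mul_log {a b : ℝ} (hb : 0 < b) (hab : a < b) {m : ℕ} (hm : m ≠ 0) :
    ∀ᶠ t : ℕ in atTop, ∀ i : ℕ, t / m ≤ i → a * Real.log t ≤ b * Real.log i := by
  filter_upwards [eventually_le_natDiv (isLittleO_rpow_natCast ((div_lt_one hb).2 hab)) hm,
    eventually_gt_atTop 0] with t ht ht0 i hi
  have ht0 : (0 : ℝ) < t := by exact_mod_cast ht0
  have hlog := Real.log_le_log (by positivity) (ht.trans (Nat.cast_le.2 hi))
  rwa [Real.log_rpow ht0, div_mul_eq_mul_div, div_le_iff₀' hb] at hlog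

/-! ### Confidence radii -/

/-- The confidence radius `√(2 a σ² log t / n)` of level `a` at time `t` for the mean of `n`
observations. For `n = 0`, where the width of the confidence interval is `+∞`, its value is `0`. -/
noncomputable def radius (a : ℝ) (σ : ℝ≥0) (t n : ℕ) : ℝ :=
  √(2 * a * (σ : ℝ) ^ 2 * Real.log t / n)

section Radius

variable {a b : ℝ} {σ : ℝ≥0} {t n : ℕ}

lemma width_eq_radius {K : ℕ} (h : History K t) (k : Fin K) :
    width a σ h k = radius a σ t (pulls h k) :=
  rfl

lemma radius_eq_sqrt (a : ℝ) (σ : ℝ≥0) (t n : ℕ) :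
    radius a σ t n = √(2 * (a * Real.log t) * (σ ^ 2 : ℝ≥0) / n) := by
  rw [radius, NNReal.coe_pow]
  ring_nf

lemma radius_eq_sqrt_mul_sqrt (ha : 0 ≤ a) (σ : ℝ≥0) (t n : ℕ) :
    radius a σ t n = √(2 * a) * √((σ : ℝ) ^ 2 * Real.log t / n) := by
  rw [radius, ← Real.sqrt_mul (by positivity)]
  ring_nf

lemma radius_le_radius_of_le {n' : ℕ} (ha : 0 ≤ a) (hn : n ≠ 0) (hnn' : n ≤ n') :
    radius a σ t n' ≤ radius a σ t n := by
  have : (0 : ℝ) < n := by exact_mod_cast hn.bot_lt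
  unfold radius
  gcongr

lemma radius_le_radius_of_mul_log_le {i : ℕ} (h : a * Real.log t ≤ b * Real.log i) :
    radius a σ t n ≤ radius b σ i n := by
  simp only [radius_eq_sqrt]
  gcongr

lemma radius_le {ε : ℝ} (hε : 0 < ε) (hn : 2 * a * σ ^ 2 / ε ^ 2 * Real.log t ≤ n) :
    radius a σ t n ≤ ε := by
  refine Real.sqrt_le_iff.2 ⟨hε.le, div_le_of_le_mul₀ n.cast_nonneg (sq_nonneg ε) ?_⟩
  calc 2 * a * (σ : ℝ) ^ 2 * Real.log t
      = ε ^ 2 * (2 * a * σ ^ 2 / ε ^ 2 * Real.log t) := by field_simp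
    _ ≤ ε ^ 2 * n := by gcongr

end Radius

lemma exp_neg_mul_log_natCast (a : ℝ) {t : ℕ} (ht : t ≠ 0) :
    Real.exp (-(a * Real.log t)) = (t : ℝ) ^ (-a) := by
  rw [Real.rpow_def_of_pos (Nat.cast_pos.2 ht.bot_lt)]
  ring_nf

/-! ### Accuracy of the empirical means -/

/-- In the first `t` rounds, the empirical mean of each arm stays within the radius of level `a` at
time `t` of the true mean. -/
def AccurateUpTo {K : ℕ} {Θ Ω : Type*} (μ : Fin K → Θ → ℝ) (θstar : Θ) (a : ℝ) (σ : ℝ≥0)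
    (A : ℕ → Ω → Fin K) (R : ℕ → Ω → ℝ) (t : ℕ) (ω : Ω) : Prop :=
  ∀ k, ∀ i ≤ t, pullCount A k i ω ≠ 0 →
    |empMean (history A R i ω) k - μ k θstar| < radius a σ t (pullCount A k i ω)

lemma AccurateUpTo.mem_confSet {K : ℕ} {Θ Ω : Type*} {μ : Fin K → Θ → ℝ} {θstar : Θ} {a α : ℝ}
    {σ : ℝ≥0} {A : ℕ → Ω → Fin K} {R : ℕ → Ω → ℝ} {t : ℕ} {ω : Ω}
    (h : AccurateUpTo μ θstar a σ A R t ω) {i : ℕ} (hi : i ≤ t)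
    (hlog : a * Real.log t ≤ α * Real.log i) : θstar ∈ confSet μ α σ (history A R i ω) := by
  intro k hk
  rw [pulls_history] at hk
  rw [abs_sub_comm, width_eq_radius, pulls_history]
  exact (h k i hi hk).trans_le (radius_le_radius_of_mul_log_le hlog)

section Accuracy

universe u

variable {K : ℕ} {Θ : Type*} {μ : Fin K → Θ → ℝ} {θstar : Θ} {a : ℝ} {σ : ℝ≥0}
  {Q : Policy K → Prop}

lemma summablyRare_deviation (hσ : 0 < σ) (ha : 0 ≤ a) {J : ℕ → ℕ}
    (hJ : Summable fun t => J t * (t : ℝ) ^ (-a)) (k : Fin K) :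
    SummablyRare (fun r : BanditRun.{u} μ θstar σ Q => r.P) fun r t => {ω | ∃ i ≤ t,
      pullCount r.A k i ω ≠ 0 ∧ pullCount r.A k i ω ≤ J t ∧ radius a σ t (pullCount r.A k i ω) ≤
        |empMean (history r.A r.R i ω) k - μ k θstar|} := by
  refine SummablyRare.of_eventually_le (hJ.mul_left 2) ?_
  filter_upwards [eventually_ne_atTop 0] with t ht r
  simp only [radius_eq_sqrt]
  exact (r.isRun.measureReal_exists_deviation_le (by positivity) (r.isRewardLaw k).2
    (mul_nonneg ha (Real.log_natCast_nonneg t)) (J t) t).trans_eq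
    (by rw [exp_neg_mul_log_natCast a ht, mul_assoc])

lemma summablyRare_not_accurateUpTo (hσ : 0 < σ) (ha : 2 < a) :
    SummablyRare (fun r : BanditRun.{u} μ θstar σ Q => r.P)
      fun r t => {ω | ¬ AccurateUpTo μ θstar a σ r.A r.R t ω} := by
  have hsum : Summable fun t : ℕ => (t : ℝ) * (t : ℝ) ^ (-a) := by
    refine (Real.summable_nat_rpow (p := 1 - a)).2 (by linarith) |>.congr fun t => ?_
    rw [sub_eq_add_neg, Real.rpow_add' t.cast_nonneg (by linarith), Real.rpow_one]
  refine (SummablyRare.iUnion (summablyRare_deviation hσ (by linarith) hsum)).mono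
    (Eventually.of_forall fun t r => ae_of_all _ fun ω hω => ?_)
  simp only [AccurateUpTo, Set.mem_ofPred_eq, not_forall, not_lt] at hω
  obtain ⟨k, i, hi, h0, hdev⟩ := hω
  exact Set.mem_iUnion.2 ⟨k, i, hi, h0, (Nat.count_le _).trans hi, hdev⟩

lemma summablyRare_deviation_floor_log (hσ : 0 < σ) (ha : 1 < a) {M : ℝ} (hM : 0 ≤ M)
    (k : Fin K) :
    SummablyRare (fun r : BanditRun.{u} μ θstar σ Q => r.P) fun r t => {ω | ∃ i ≤ t,
      pullCount r.A k i ω ≠ 0 ∧ pullCount r.A k i ω ≤ ⌊M * Real.log t⌋₊ ∧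
      radius a σ t (pullCount r.A k i ω) ≤
        |empMean (history r.A r.R i ω) k - μ k θstar|} := by
  refine summablyRare_deviation hσ (by linarith) ?_ k
  set ε := (a - 1) / 2 with hε
  have hε0 : 0 < ε := by linarith
  refine Summable.of_nonneg_of_le (fun t => by positivity) (fun t => ?_)
    ((Real.summable_nat_rpow (p := ε - a)).2 (by linarith) |>.mul_left (M / ε))
  have hlog : (⌊M * Real.log t⌋₊ : ℝ) ≤ M * ((t : ℝ) ^ ε / ε) :=
    (Nat.floor_le (mul_nonneg hM (Real.log_natCast_nonneg t))).trans
      (mul_le_mul_of_nonneg_left (Real.log_le_rpow_div t.cast_nonneg hε0) hM)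
  calc (⌊M * Real.log t⌋₊ : ℝ) * (t : ℝ) ^ (-a) ≤ M * ((t : ℝ) ^ ε / ε) * (t : ℝ) ^ (-a) := by
        gcongr
    _ = M / ε * (t : ℝ) ^ (ε - a) := by
        rw [sub_eq_add_neg, Real.rpow_add' t.cast_nonneg (by linarith)]
        ring

lemma summablyRare_notMem_confSet (hσ : 0 < σ) (ha : 2 < a) :
    SummablyRare (fun r : BanditRun.{u} μ θstar σ Q => r.P)
      fun r t => {ω | θstar ∉ confSet μ a σ (history r.A r.R t ω)} :=
  (summablyRare_not_accurateUpTo hσ ha).mono <| Eventually.of_forall fun _ _ => ae_of_all _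
    fun _ hω hacc => hω (hacc.mem_confSet le_rfl le_rfl)

end Accuracy

/-! ### Non-competitive arms -/

section Candidates

variable {K t : ℕ} {Θ : Type*} {μ : Fin K → Θ → ℝ} {θstar : Θ} {kstar : Fin K} {α : ℝ}
  {σ : ℝ≥0} {h : History K t}

lemma mem_candidates_of_forall_le (hopt : ∀ k, μ k θstar ≤ μ kstar θstar)
    (hθ : θstar ∈ confSet μ α σ h) : kstar ∈ candidates μ α σ h :=
  Or.inr ⟨θstar, hθ, hopt⟩

lemma notMem_candidates {ε : ℝ} {k : Fin K} (hθ : θstar ∈ confSet μ α σ h)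
    (hk : ¬ CompetitiveOn μ (levelNbhd μ kstar θstar ε) k) (hn : pulls h kstar ≠ 0)
    (hw : width α σ h kstar ≤ ε / 2) : k ∉ candidates μ α σ h := by
  rintro (hempty | ⟨θ, hθ', hmax⟩)
  · exact Set.notMem_empty θstar (hempty ▸ hθ)
  · refine hk ⟨θ, ?_, hmax⟩
    calc |μ kstar θstar - μ kstar θ|
        ≤ |μ kstar θstar - empMean h kstar| + |empMean h kstar - μ kstar θ| := abs_sub_le _ _ _
      _ < ε := by linarith [hθ kstar hn, hθ' kstar hn, abs_sub_comm (empMean h kstar) (μ kstar θ)]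

end Candidates

section NonCompetitive

universe u

variable {K : ℕ} {Θ : Type*} {μ : Fin K → Θ → ℝ} {θstar : Θ} {kstar : Fin K} {α : ℝ} {σ : ℝ≥0}
  {Q : Policy K → Prop}

lemma summablyRare_arm_of_not_competitive (hσ : 0 < σ) (hα : 2 < α)
    (hQ : ∀ π, Q π → ∀ t (h : History K t) k, π t h {k} ≠ 0 → k ∈ candidates μ α σ h)
    (hstarved : ∀ M : ℝ, 0 < M → SummablyRare (fun r : BanditRun.{u} μ θstar σ Q => r.P)
      fun r t => {ω | (pullCount r.A kstar t ω : ℝ) < M * Real.log t})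
    {k : Fin K} (hk : ¬ Competitive μ kstar θstar k) :
    SummablyRare (fun r : BanditRun.{u} μ θstar σ Q => r.P) fun r t => {ω | r.A t ω = k} := by
  obtain ⟨ε, hε, hk⟩ : ∃ ε > 0, ¬ CompetitiveOn μ (levelNbhd μ kstar θstar ε) k := by
    simpa [Competitive] using hk
  set M : ℝ := 2 * α * σ ^ 2 / (ε / 2) ^ 2
  have hM : 0 < M := by positivity
  refine ((summablyRare_notMem_confSet hσ hα).union (hstarved M hM)).mono ?_
  filter_upwards [eventually_ge_atTop 2] with t ht r
  filter_upwards [r.isRun.ae_apply_ne_zero] with ω hω hA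
  by_contra! hcon
  simp only [Set.mem_union, Set.mem_ofPred_eq, not_or, not_not, not_lt] at hcon hA
  obtain ⟨hθ, hM'⟩ := hcon
  have hlog : 0 < Real.log t := Real.log_pos (by exact_mod_cast ht)
  have hn : pullCount r.A kstar t ω ≠ 0 := by
    exact_mod_cast ((mul_pos hM hlog).trans_le hM').ne'
  rw [← pulls_history (R := r.R)] at hn hM'
  exact notMem_candidates hθ hk hn (radius_le (by positivity) hM')
    (hQ r.π r.policy_mem t _ k (hA ▸ hω t))

end NonCompetitive

/-! ### UCB-C -/

section UCB

universe u

variable {K : ℕ} {Θ : Type*} {μ : Fin K → Θ → ℝ} {θstar : Θ} {kstar : Fin K} {α : ℝ} {σ : ℝ≥0}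

lemma IsUCBC.index_le {π : Policy K} (hπ : IsUCBC μ α σ π)
    (hopt : ∀ k, μ k θstar ≤ μ kstar θstar) {t : ℕ} {h : History K t}
    (hθ : θstar ∈ confSet μ α σ h) {l : Fin K} (hl : π t h {l} ≠ 0) (hn : pulls h l ≠ 0) :
    pulls h kstar ≠ 0 ∧
      empMean h kstar + width α σ h kstar ≤ empMean h l + width α σ h l := by
  have hidx := (hπ t h l hl).2 kstar (mem_candidates_of_forall_le hopt hθ)
  have hstar : pulls h kstar ≠ 0 := by
    intro h0
    rw [ucbIndex, ucbIndex, if_pos h0, if_neg hn, top_le_iff] at hidx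
    exact EReal.coe_ne_top _ hidx
  rw [ucbIndex, ucbIndex, if_neg hstar, if_neg hn] at hidx
  exact ⟨hstar, by exact_mod_cast hidx⟩

lemma IsUCBC.sub_lt_two_mul_width {π : Policy K} (hπ : IsUCBC μ α σ π)
    (hopt : ∀ k, μ k θstar ≤ μ kstar θstar) {t : ℕ} {h : History K t}
    (hθ : θstar ∈ confSet μ α σ h) {l : Fin K} (hl : π t h {l} ≠ 0) (hn : pulls h l ≠ 0) :
    μ kstar θstar - μ l θstar < 2 * width α σ h l := by
  obtain ⟨hstar, hidx⟩ := hπ.index_le hopt hθ hl hn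
  linarith [(abs_lt.1 (hθ kstar hstar)).2, (abs_lt.1 (hθ l hn)).1]

lemma sq_mul_le_sq_mul_of_mul_sqrt_div_le {c d x m n : ℝ} (hx : 0 < x) (hm : 0 < m) (hn : 0 < n)
    (hc : 0 ≤ c) (h : c * √(x / m) ≤ d * √(x / n)) : c ^ 2 * n ≤ d ^ 2 * m := by
  have hsq := pow_le_pow_left₀ (by positivity) h 2
  rw [mul_pow, mul_pow, Real.sq_sqrt (by positivity), Real.sq_sqrt (by positivity),
    ← mul_div_assoc, ← mul_div_assoc, div_le_div_iff₀ hm hn] at hsq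
  exact le_of_mul_le_mul_right (by linarith) hx

lemma IsUCBC.mul_pulls_le {π : Policy K} (hπ : IsUCBC μ α σ π)
    (hopt : ∀ k, μ k θstar ≤ μ kstar θstar) (hσ : 0 < σ) {a a' : ℝ} (ha : 0 ≤ a) (haa' : a ≤ a')
    (hα : 0 ≤ α) {i t : ℕ} (hit : i ≤ t) (ht : 0 < Real.log t)
    (hlog : a' * Real.log t ≤ α * Real.log i) {h : History K i}
    (hacc : ∀ k, pulls h k ≠ 0 → |empMean h k - μ k θstar| < radius a σ t (pulls h k))
    {l : Fin K} (hl : π i h {l} ≠ 0) (hn : pulls h l ≠ 0) :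
    (√(2 * a') - √(2 * a)) ^ 2 * pulls h l ≤ (√(2 * a) + √(2 * α)) ^ 2 * pulls h kstar := by
  have hθ : θstar ∈ confSet μ α σ h := fun k hk => by
    rw [abs_sub_comm, width_eq_radius]
    refine (hacc k hk).trans_le (radius_le_radius_of_mul_log_le (le_trans ?_ hlog))
    gcongr
  obtain ⟨hstar, hidx⟩ := hπ.index_le hopt hθ hl hn
  have hwstar : radius a' σ t (pulls h kstar) ≤ width α σ h kstar :=
    radius_le_radius_of_mul_log_le hlog
  have hwl : width α σ h l ≤ radius α σ t (pulls h l) :=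
    radius_le_radius_of_mul_log_le (mul_le_mul_of_nonneg_left (monotone_log_natCast hit) hα)
  have hdstar := (abs_lt.1 (hacc kstar hstar)).1
  have hdl := (abs_lt.1 (hacc l hn)).2
  rw [radius_eq_sqrt_mul_sqrt (by linarith)] at hwstar hwl hdstar hdl
  refine sq_mul_le_sq_mul_of_mul_sqrt_div_le (x := (σ : ℝ) ^ 2 * Real.log t) (by positivity)
    (by exact_mod_cast hstar.bot_lt) (by exact_mod_cast hn.bot_lt)
    (sub_nonneg.2 (by gcongr)) ?_
  linarith [hopt l]

lemma IsUCBC.summablyRare_pullCount_lt (hopt : ∀ k, μ k θstar ≤ μ kstar θstar) (hσ : 0 < σ)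
    (hα : 2 < α) {M : ℝ} (hM : 0 < M) :
    SummablyRare (fun r : BanditRun.{u} μ θstar σ (IsUCBC μ α σ) => r.P)
      fun r t => {ω | (pullCount r.A kstar t ω : ℝ) < M * Real.log t} := by
  obtain ⟨a, ha, haα⟩ := exists_between hα
  obtain ⟨a', haa', ha'α⟩ := exists_between haα
  have hK : 2 * Fintype.card (Fin K) ≠ 0 := by simpa using kstar.pos.ne'
  set κ := √(2 * a') - √(2 * a)
  set b := √(2 * a) + √(2 * α)
  have hκ : 0 < κ := sub_pos.2 (Real.sqrt_lt_sqrt (by linarith) (by linarith))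
  have hb : 0 < b := by positivity
  refine (summablyRare_not_accurateUpTo hσ ha).mono ?_
  filter_upwards [eventually_ge_atTop 2, eventually_mul_log_le_mul_log (by linarith) ha'α hK,
    eventually_mul_log_le_natDiv (b ^ 2 * M / κ ^ 2) hK] with t ht hlog hN r
  have ht0 : 0 < Real.log t := Real.log_pos (by exact_mod_cast ht)
  set N := t / (2 * Fintype.card (Fin K))
  have hN0 : 0 < N := by exact_mod_cast (by positivity : 0 < b ^ 2 * M / κ ^ 2 * _).trans_le hN
  filter_upwards [r.isRun.ae_apply_ne_zero] with ω hω hstarved hacc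
  have : Nonempty (Fin K) := ⟨kstar⟩
  obtain ⟨l, hl⟩ := exists_div_le_count (fun i => r.A i ω) t
  obtain ⟨i, hit, rfl, hNi⟩ := Nat.count_ne_iff_exists.1 (hN0.trans_le hl).ne'
  have hmul := r.policy_mem.mul_pulls_le hopt hσ (by linarith) haa'.le (by linarith) hit.le ht0
    (hlog i (hNi.trans (Nat.count_le _))) (h := history r.A r.R i ω)
    (fun k => by simpa only [pulls_history] using hacc k i hit.le) (hω i)
    (by rw [pulls_history]; exact (hN0.trans_le hNi).ne')
  rw [pulls_history, pulls_history] at hmul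
  refine lt_irrefl (κ ^ 2 * N) ?_
  calc κ ^ 2 * (N : ℝ) ≤ κ ^ 2 * pullCount r.A (r.A i ω) i ω := by gcongr; exact hNi
    _ ≤ b ^ 2 * pullCount r.A kstar i ω := hmul
    _ ≤ b ^ 2 * pullCount r.A kstar t ω := by
      gcongr
      exact Nat.count_monotone _ hit.le
    _ < b ^ 2 * (M * Real.log t) := by gcongr
    _ = κ ^ 2 * (b ^ 2 * M / κ ^ 2 * Real.log t) := by field_simp
    _ ≤ κ ^ 2 * N := by gcongr

lemma IsUCBC.exists_summablyRare_arm (hopt : ∀ k, μ k θstar ≤ μ kstar θstar) (hσ : 0 < σ)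
    (hα : 2 < α) {k : Fin K} (hk : μ k θstar < μ kstar θstar) :
    ∃ L : ℝ, 0 ≤ L ∧ SummablyRare (fun r : BanditRun.{u} μ θstar σ (IsUCBC μ α σ) => r.P)
      fun r t => {ω | r.A t ω = k ∧ L * Real.log t ≤ pullCount r.A k t ω} := by
  have hΔ : 0 < (μ kstar θstar - μ k θstar) / 2 := half_pos (sub_pos.2 hk)
  set L : ℝ := 2 * α * σ ^ 2 / ((μ kstar θstar - μ k θstar) / 2) ^ 2
  have hL : 0 < L := by positivity
  refine ⟨L, hL.le, (summablyRare_notMem_confSet hσ hα).mono ?_⟩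
  filter_upwards [eventually_ge_atTop 2] with t ht r
  filter_upwards [r.isRun.ae_apply_ne_zero] with ω hω ⟨hA, hn⟩ hθ
  have hlog : 0 < Real.log t := Real.log_pos (by exact_mod_cast ht)
  have hn0 : pullCount r.A k t ω ≠ 0 := by exact_mod_cast ((mul_pos hL hlog).trans_le hn).ne'
  rw [← pulls_history (R := r.R)] at hn hn0
  have hgap := r.policy_mem.sub_lt_two_mul_width hopt hθ (hA ▸ hω t) hn0
  rw [width_eq_radius] at hgap
  linarith [radius_le hΔ hn]

end UCB

/-! ### Rounds of TS-C -/

lemma pi_univ_pi_update {ι : Type*} [Fintype ι] [DecidableEq ι] {X : ι → Type*}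
    [∀ i, MeasurableSpace (X i)] (m : ∀ i, Measure (X i)) [∀ i, IsProbabilityMeasure (m i)]
    {s : ∀ i, Set (X i)} {k : ι} (hk : s k = Set.univ) (u : Set (X k)) :
    Measure.pi m (Set.univ.pi (Function.update s k u)) = m k u * Measure.pi m (Set.univ.pi s) := by
  rw [Measure.pi_pi, Measure.pi_pi, ← Finset.mul_prod_erase _ _ (Finset.mem_univ k),
    ← Finset.mul_prod_erase _ (fun i => m i (s i)) (Finset.mem_univ k), hk, measure_univ, one_mul,
    Function.update_self]
  congr 1
  exact Finset.prod_congr rfl fun i hi => by rw [Function.update_of_ne (Finset.ne_of_mem_erase hi)]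

/-- The law `N(μ̂_k(t), β σ² / n_k(t))` of the Thompson sample of arm `k`. For `n_k(t) = 0` it is
the Dirac measure at `0`, in place of a Gaussian law of infinite variance. -/
noncomputable def posterior {K t : ℕ} (β σ : ℝ≥0) (h : History K t) (k : Fin K) : Measure ℝ :=
  gaussianReal (empMean h k) (β * σ ^ 2 / (pulls h k : ℝ≥0))

section Posterior

variable {K i t : ℕ} {β σ : ℝ≥0} {h : History K i} {k : Fin K}

instance : IsProbabilityMeasure (posterior β σ h k) := by
  unfold posterior
  infer_instance

instance : IsProbabilityMeasure (tsLaw β σ h) := by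
  unfold tsLaw
  infer_instance

lemma tsLaw_real_eval_mem (k : Fin K) {s : Set ℝ} (hs : MeasurableSet s) :
    (tsLaw β σ h).real {S | S k ∈ s} = (posterior β σ h k).real s :=
  (measurePreserving_eval (posterior β σ h) k).measureReal_preimage hs.nullMeasurableSet

lemma tsLaw_real_le_eval_and_forall_le (C : Set (Fin K)) (k : Fin K) (y : ℝ) :
    (tsLaw β σ h).real {S | y ≤ S k ∧ ∀ j ∈ C, j ≠ k → S j ≤ y} =
      (posterior β σ h k).real (Set.Ici y) *
        (tsLaw β σ h).real {S | ∀ j ∈ C, j ≠ k → S j ≤ y} := by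
  set s : Fin K → Set ℝ := fun j => {x | j ∈ C → j ≠ k → x ≤ y}
  have hbox : {S : Fin K → ℝ | ∀ j ∈ C, j ≠ k → S j ≤ y} = Set.univ.pi s := by
    ext S
    simp [s]
  have hupd : {S : Fin K → ℝ | y ≤ S k ∧ ∀ j ∈ C, j ≠ k → S j ≤ y} =
      Set.univ.pi (Function.update s k (Set.Ici y)) := by
    ext S
    rw [Set.mem_univ_pi, Function.forall_update_iff s fun j u => S j ∈ u]
    simp only [s, Set.mem_ofPred_eq, Set.mem_Ici]
    grind
  have hpi := pi_univ_pi_update (posterior β σ h) (s := s) (k := k) (by simp [s]) (Set.Ici y)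
  rw [hbox, hupd, measureReal_def, measureReal_def, measureReal_def, ← ENNReal.toReal_mul]
  exact congrArg ENNReal.toReal hpi

lemma radius_mul_eq_sqrt (c : ℝ) (β σ : ℝ≥0) (t n : ℕ) :
    radius (c * β) σ t n = √(2 * (c * Real.log t) * (β * σ ^ 2 / n : ℝ≥0)) := by
  rw [radius]
  push_cast
  ring_nf

lemma posterior_real_Ici_le (hσ : 0 < σ) (hβ : 0 < β) (hk : pulls h k ≠ 0) (ht : t ≠ 0) {c y : ℝ}
    (hc : 0 ≤ c) (hy : empMean h k + radius (c * β) σ t (pulls h k) ≤ y) :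
    (posterior β σ h k).real (Set.Ici y) ≤ (t : ℝ) ^ (-c) := by
  rw [← exp_neg_mul_log_natCast c ht]
  rw [radius_mul_eq_sqrt] at hy
  exact (measureReal_mono (Set.Ici_subset_Ici.2 hy)).trans <| gaussianReal_Ici_add_sqrt_le _
    (by positivity) (mul_nonneg hc (Real.log_natCast_nonneg t))

lemma posterior_real_Iic_le (hσ : 0 < σ) (hβ : 0 < β) (hk : pulls h k ≠ 0) (ht : t ≠ 0) {c y : ℝ}
    (hc : 0 ≤ c) (hy : y ≤ empMean h k - radius (c * β) σ t (pulls h k)) :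
    (posterior β σ h k).real (Set.Iic y) ≤ (t : ℝ) ^ (-c) := by
  rw [← exp_neg_mul_log_natCast c ht]
  rw [radius_mul_eq_sqrt] at hy
  exact (measureReal_mono (Set.Iic_subset_Iic.2 hy)).trans <| gaussianReal_Iic_sub_sqrt_le _
    (by positivity) (mul_nonneg hc (Real.log_natCast_nonneg t))

lemma le_posterior_real_Ici (hσ : 0 < σ) (hβ : 0 < β) (hk : pulls h k ≠ 0) {a m d : ℝ}
    (ha : 0 ≤ a) (hm : m - radius a σ t (pulls h k) ≤ empMean h k)
    (hd : d ≤ √(β * σ ^ 2 / (pulls h k : ℝ≥0) : ℝ≥0)) :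
    (√(2 * Real.pi))⁻¹ * Real.exp (-(1 + √(2 * (a / β * Real.log t)) + 1) ^ 2 / 2) ≤
      (posterior β σ h k).real (Set.Ici (m + d)) := by
  have := Real.log_natCast_nonneg t
  refine (le_gaussianReal_Ici (empMean h k) (v := β * σ ^ 2 / (pulls h k : ℝ≥0)) (by positivity)
    (by positivity)).trans (measureReal_mono (Set.Ici_subset_Ici.2 ?_))
  have hrad : radius a σ t (pulls h k) = √(2 * (a / β * Real.log t)) *
      √(β * σ ^ 2 / (pulls h k : ℝ≥0) : ℝ≥0) := by
    rw [← Real.sqrt_mul (by positivity), ← radius_mul_eq_sqrt, div_mul_cancel₀]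
    exact_mod_cast hβ.ne'
  linarith

end Posterior

section TSRound

variable {K i t : ℕ} {Θ : Type*} {μ : Fin K → Θ → ℝ} {θstar : Θ} {kstar k l : Fin K} {α : ℝ}
  {β σ : ℝ≥0} {h : History K i} {π : Policy K}

lemma IsTSC.mem_candidates (hπ : IsTSC μ α β σ π) (hk : π i h {k} ≠ 0) :
    k ∈ candidates μ α σ h := by
  by_cases hu : ∃ j ∈ candidates μ α σ h, pulls h j = 0
  · exact ((hπ i h).1 hu k hk).1
  · push Not at hu
    exact not_imp_comm.1 (((hπ i h).2 hu).2 k) hk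

lemma IsTSC.apply_eq_tsLaw (hπ : IsTSC μ α β σ π) (hk : pulls h k ≠ 0) (h0 : π i h {k} ≠ 0)
    {j : Fin K} (hj : j ∈ candidates μ α σ h) :
    pulls h j ≠ 0 ∧ π i h {j} = tsLaw β σ h {S | ∀ l ∈ candidates μ α σ h, S l ≤ S j} := by
  have hu : ∀ j ∈ candidates μ α σ h, pulls h j ≠ 0 := fun j hj hj0 =>
    hk ((hπ i h).1 ⟨j, hj, hj0⟩ k h0).2
  exact ⟨hu j hj, ((hπ i h).2 hu).1 j hj⟩

lemma IsTSC.real_apply_le_add (hπ : IsTSC μ α β σ π) (hk : pulls h k ≠ 0)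
    (hstar : kstar ∈ candidates μ α σ h) (y : ℝ) :
    (π i h).real {k} ≤
      (posterior β σ h k).real (Set.Ici y) + (posterior β σ h kstar).real (Set.Iic y) := by
  by_cases h0 : π i h {k} = 0
  · rw [measureReal_def, h0, ENNReal.toReal_zero]
    positivity
  rw [measureReal_def, (hπ.apply_eq_tsLaw hk h0 (hπ.mem_candidates h0)).2, ← measureReal_def,
    ← tsLaw_real_eval_mem k measurableSet_Ici, ← tsLaw_real_eval_mem kstar measurableSet_Iic]
  refine (measureReal_mono fun S hS => ?_).trans (measureReal_union_le _ _)
  exact (le_total y (S k)).imp id (hS kstar hstar).trans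

lemma IsTSC.posterior_mul_real_apply_le (hπ : IsTSC μ α β σ π) (hl : pulls h l ≠ 0)
    (hstar : kstar ∈ candidates μ α σ h) (y : ℝ) :
    (posterior β σ h kstar).real (Set.Ici y) * (π i h).real {l} ≤
      (posterior β σ h l).real (Set.Ici y) + (π i h).real {kstar} := by
  by_cases h0 : π i h {l} = 0
  · rw [measureReal_def (π i h) {l}, h0, ENNReal.toReal_zero, mul_zero]
    positivity
  set C := candidates μ α σ h
  set p := (posterior β σ h kstar).real (Set.Ici y)
  set b := (tsLaw β σ h).real {S | ∀ j ∈ C, j ≠ kstar → S j ≤ y}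
  have hlaw {j : Fin K} (hj : j ∈ C) :
      (π i h).real {j} = (tsLaw β σ h).real {S | ∀ l ∈ C, S l ≤ S j} :=
    congrArg ENNReal.toReal (hπ.apply_eq_tsLaw hl h0 hj).2
  have hpull : (π i h).real {l} ≤ (posterior β σ h l).real (Set.Ici y) + b := by
    rw [hlaw (hπ.mem_candidates h0), ← tsLaw_real_eval_mem l measurableSet_Ici]
    refine (measureReal_mono fun S hS => ?_).trans (measureReal_union_le _ _)
    exact (le_total y (S l)).imp id fun hy j hj _ => (hS j hj).trans hy
  have hstar_pull : p * b ≤ (π i h).real {kstar} := by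
    rw [hlaw hstar, ← tsLaw_real_le_eval_and_forall_le]
    refine measureReal_mono fun S hS j hj => ?_
    rcases eq_or_ne j kstar with rfl | hne
    exacts [le_rfl, (hS.2 j hj hne).trans hS.1]
  calc p * (π i h).real {l} ≤ p * (posterior β σ h l).real (Set.Ici y) + p * b := by
        rw [← mul_add]
        gcongr
    _ ≤ (posterior β σ h l).real (Set.Ici y) + (π i h).real {kstar} :=
        add_le_add (mul_le_of_le_one_left measureReal_nonneg measureReal_le_one) hstar_pull

lemma IsTSC.real_apply_le_two_mul_rpow (hπ : IsTSC μ α β σ π)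
    (hopt : ∀ k, μ k θstar ≤ μ kstar θstar) (hσ : 0 < σ) (hβ : 0 < β)
    (hθ : θstar ∈ confSet μ α σ h) (ht : t ≠ 0) {c : ℝ} (hc : 0 ≤ c)
    (hk : pulls h k ≠ 0) (hstar : pulls h kstar ≠ 0)
    (hgap : width α σ h k + radius (c * β) σ t (pulls h k) ≤ (μ kstar θstar - μ k θstar) / 2)
    (hgap_star : width α σ h kstar + radius (c * β) σ t (pulls h kstar) ≤
      (μ kstar θstar - μ k θstar) / 2) :
    (π i h).real {k} ≤ 2 * (t : ℝ) ^ (-c) := by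
  set y := (μ kstar θstar + μ k θstar) / 2 with hy
  have hdev := (abs_lt.1 (hθ k hk)).1
  have hdev_star := (abs_lt.1 (hθ kstar hstar)).2
  calc (π i h).real {k}
      ≤ (posterior β σ h k).real (Set.Ici y) + (posterior β σ h kstar).real (Set.Iic y) :=
        hπ.real_apply_le_add hk (mem_candidates_of_forall_le hopt hθ) y
    _ ≤ (t : ℝ) ^ (-c) + (t : ℝ) ^ (-c) :=
        add_le_add (posterior_real_Ici_le hσ hβ hk ht hc (by linarith))
          (posterior_real_Iic_le hσ hβ hstar ht hc (by linarith))
    _ = 2 * (t : ℝ) ^ (-c) := (two_mul _).symm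

lemma radius_add_radius_le_sqrt {a : ℝ} (ha : 0 ≤ a) {N n : ℕ} (hN : N ≠ 0) (hn : n ≠ 0)
    (h : (√(2 * a) + √(2 * β)) ^ 2 * Real.log t * n ≤ β * N) :
    radius a σ t N + radius β σ t N ≤ √(β * σ ^ 2 / n : ℝ≥0) := by
  have hN0 : (0 : ℝ) < N := by exact_mod_cast hN.bot_lt
  have hn0 : (0 : ℝ) < n := by exact_mod_cast hn.bot_lt
  have := Real.log_natCast_nonneg t
  rw [radius_eq_sqrt_mul_sqrt ha, radius_eq_sqrt_mul_sqrt β.coe_nonneg, ← add_mul]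
  refine Real.le_sqrt_of_sq_le ?_
  rw [mul_pow, Real.sq_sqrt (by positivity)]
  push_cast
  rw [← mul_div_assoc, div_le_div_iff₀ hN0 hn0]
  calc (√(2 * a) + √(2 * β)) ^ 2 * ((σ : ℝ) ^ 2 * Real.log t) * n
      = (σ : ℝ) ^ 2 * ((√(2 * a) + √(2 * β)) ^ 2 * Real.log t * n) := by ring
    _ ≤ (σ : ℝ) ^ 2 * (β * N) := by gcongr
    _ = β * σ ^ 2 * N := by ring

lemma IsTSC.mul_real_apply_le (hπ : IsTSC μ α β σ π)
    (hopt : ∀ k, μ k θstar ≤ μ kstar θstar) (hσ : 0 < σ) (hβ : 0 < β)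
    (hθ : θstar ∈ confSet μ α σ h) {a a' q : ℝ} (ha : 0 ≤ a) (ha' : 0 ≤ a') (ht : t ≠ 0)
    {N : ℕ} (hN : N ≠ 0) (hNl : N ≤ pulls h l)
    (hacc : |empMean h l - μ l θstar| < radius a σ t (pulls h l))
    (hacc_star : pulls h kstar ≠ 0 →
      |empMean h kstar - μ kstar θstar| < radius a' σ t (pulls h kstar))
    (hstarved : (√(2 * a) + √(2 * β)) ^ 2 * Real.log t * pulls h kstar ≤ β * N)
    (hq : 2 * q ≤ (√(2 * Real.pi))⁻¹ *
      Real.exp (-(1 + √(2 * (a' / β * Real.log t)) + 1) ^ 2 / 2)) :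
    q * (π i h).real {l} ≤ (t : ℝ)⁻¹ + 2⁻¹ * (π i h).real {kstar} := by
  have hl : pulls h l ≠ 0 := (hN.bot_lt.trans_le hNl).ne'
  have hstar := mem_candidates_of_forall_le hopt hθ
  by_cases h0 : π i h {l} = 0
  · rw [measureReal_def (π i h) {l}, h0, ENNReal.toReal_zero, mul_zero]
    positivity
  have hnstar := (hπ.apply_eq_tsLaw hl h0 hstar).1
  set y := μ kstar θstar + (radius a σ t N + radius β σ t N)
  have hupper : (posterior β σ h l).real (Set.Ici y) ≤ (t : ℝ)⁻¹ := by
    rw [← Real.rpow_neg_one]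
    refine posterior_real_Ici_le hσ hβ hl ht zero_le_one ?_
    rw [one_mul]
    linarith [(abs_lt.1 hacc).2, hopt l, radius_le_radius_of_le (σ := σ) (t := t) ha hN hNl,
      radius_le_radius_of_le (σ := σ) (t := t) β.coe_nonneg hN hNl]
  have hlower : 2 * q ≤ (posterior β σ h kstar).real (Set.Ici y) :=
    hq.trans <| le_posterior_real_Ici hσ hβ hnstar ha'
      (by linarith [(abs_lt.1 (hacc_star hnstar)).1])
      (radius_add_radius_le_sqrt ha hN hnstar hstarved)
  have hcompare := hπ.posterior_mul_real_apply_le hl hstar y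
  linarith [mul_le_mul_of_nonneg_right hlower (measureReal_nonneg (μ := π i h) (s := {l})),
    inv_nonneg.2 (t.cast_nonneg (α := ℝ))]

end TSRound

/-! ### Dominated rounds -/

lemma eventually_two_mul_rpow_le_gaussian_tail {ρ : ℝ} (hρ0 : 0 ≤ ρ) (hρ : ρ < 1) :
    ∀ᶠ t : ℕ in atTop, 2 * (t : ℝ) ^ (-((1 + ρ) / 2)) ≤
      (√(2 * Real.pi))⁻¹ * Real.exp (-(1 + √(2 * (ρ * Real.log t)) + 1) ^ 2 / 2) := by
  set ε : ℝ := (1 - ρ) / 4 with hε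
  have hε0 : 0 < ε := by linarith
  set C : ℝ := Real.log (2 * √(2 * Real.pi))
  filter_upwards [(Real.tendsto_log_atTop.comp tendsto_natCast_atTop_atTop).eventually_ge_atTop
    ((2 + 2 / ε + C) / ε), eventually_gt_atTop 0] with t ht ht0
  have hlog : 0 ≤ Real.log t := Real.log_natCast_nonneg t
  rw [Function.comp_apply, div_le_iff₀ hε0] at ht
  set s := √(2 * (ρ * Real.log t))
  have hs : s ^ 2 = 2 * (ρ * Real.log t) := Real.sq_sqrt (by positivity)
  have hyoung : 4 * s ≤ ε * s ^ 2 + 4 / ε := by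
    have hsq : ε * s ^ 2 + 4 / ε - 4 * s = (ε * s - 2) ^ 2 / ε := by field_simp; ring
    linarith [div_nonneg (sq_nonneg (ε * s - 2)) hε0.le]
  have hρlog : ε * (ρ * Real.log t) ≤ ε * Real.log t :=
    mul_le_mul_of_nonneg_left (mul_le_of_le_one_left hlog hρ.le) hε0.le
  have hexponent : C + (1 + s + 1) ^ 2 / 2 ≤ (1 + ρ) / 2 * Real.log t := by
    calc C + (1 + s + 1) ^ 2 / 2 = C + 2 + (4 * s + s ^ 2) / 2 := by ring
      _ ≤ C + 2 + (ε * s ^ 2 + 4 / ε + s ^ 2) / 2 := by gcongr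
      _ = (2 + 2 / ε + C) + ρ * Real.log t + ε * (ρ * Real.log t) := by rw [hs]; ring
      _ ≤ Real.log t * ε + ρ * Real.log t + ε * Real.log t := by gcongr
      _ = (1 + ρ) / 2 * Real.log t := by rw [hε]; ring
  rw [le_inv_mul_iff₀ (by positivity), ← exp_neg_mul_log_natCast _ ht0.ne', ← mul_assoc,
    mul_comm _ (2 : ℝ), ← Real.exp_log (show 0 < 2 * √(2 * Real.pi) by positivity), ← Real.exp_add]
  exact Real.exp_le_exp.2 (by linarith)

lemma two_pow_floor_mul_log_le {M : ℝ} (hM : 0 ≤ M) {t : ℕ} (ht : t ≠ 0) :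
    (2 : ℝ) ^ ⌊M * Real.log t⌋₊ ≤ (t : ℝ) ^ M := by
  have := Real.log_natCast_nonneg t
  calc (2 : ℝ) ^ ⌊M * Real.log t⌋₊ ≤ Real.exp 1 ^ ⌊M * Real.log t⌋₊ := by
        gcongr
        linarith [Real.add_one_le_exp (1 : ℝ)]
    _ = Real.exp ⌊M * Real.log t⌋₊ := by rw [← Real.exp_nat_mul, mul_one]
    _ ≤ Real.exp (M * Real.log t) := by
        gcongr
        exact Nat.floor_le (by positivity)
    _ = (t : ℝ) ^ M := by rw [Real.rpow_def_of_pos (by exact_mod_cast ht.bot_lt), mul_comm]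

lemma half_le_log_one_add {x : ℝ} (hx0 : 0 ≤ x) (hx : x ≤ 2) : x / 2 ≤ Real.log (1 + x) := by
  refine le_trans ?_ (Real.le_log_one_add_of_nonneg hx0)
  rw [div_le_div_iff₀ two_pos (by linarith)]
  nlinarith

lemma eventually_rpow_le_one_add_rpow_neg_pow (C : ℝ) {ρ : ℝ} (hρ0 : 0 ≤ ρ) (hρ : ρ < 1) {m : ℕ}
    (hm : m ≠ 0) : ∀ᶠ t : ℕ in atTop, (t : ℝ) ^ C ≤ (1 + (t : ℝ) ^ (-ρ)) ^ (t / m) := by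
  filter_upwards [eventually_le_natDiv
    ((isLittleO_rpow_mul_log_natCast hρ).const_mul_left (2 * C)) hm, eventually_gt_atTop 0]
    with t hN ht
  have ht0 : (0 : ℝ) < t := by exact_mod_cast ht
  set q := (t : ℝ) ^ (-ρ)
  have hq0 : 0 < q := by positivity
  have hq1 : q ≤ 1 := Real.rpow_le_one_of_one_le_of_nonpos (by exact_mod_cast ht) (by linarith)
  have hcancel : (t : ℝ) ^ ρ * q = 1 := by rw [← Real.rpow_add ht0, add_neg_cancel, Real.rpow_zero]
  rw [Real.rpow_def_of_pos ht0, ← Real.rpow_natCast (1 + q), Real.rpow_def_of_pos (by positivity)]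
  refine Real.exp_le_exp.2 ?_
  calc Real.log t * C = 2 * C * ((t : ℝ) ^ ρ * Real.log t) * (q / 2) := by
        linear_combination (-(C * Real.log t)) * hcancel
    _ ≤ (t / m : ℕ) * (q / 2) := by gcongr
    _ ≤ (t / m : ℕ) * Real.log (1 + q) := by
        gcongr
        exact half_le_log_one_add hq0.le (by linarith)
    _ = Real.log (1 + q) * (t / m : ℕ) := mul_comm _ _

lemma eventually_one_add_inv_pow_mul_two_pow_div_le {M ρ : ℝ} (hM : 0 ≤ M) (hρ0 : 0 ≤ ρ)
    (hρ : ρ < 1) {m : ℕ} (hm : m ≠ 0) :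
    ∀ᶠ t : ℕ in atTop, (1 + (t : ℝ)⁻¹) ^ t * 2 ^ ⌊M * Real.log t⌋₊ /
      (1 + (t : ℝ) ^ (-ρ)) ^ (t / m) ≤ Real.exp 1 * (t : ℝ) ^ (-2 : ℝ) := by
  filter_upwards [eventually_rpow_le_one_add_rpow_neg_pow (M + 2) hρ0 hρ hm,
    eventually_ne_atTop 0] with t hpow ht
  have ht0 : (0 : ℝ) < t := by exact_mod_cast ht.bot_lt
  have hexp : (1 + (t : ℝ)⁻¹) ^ t ≤ Real.exp 1 := by
    calc (1 + (t : ℝ)⁻¹) ^ t ≤ Real.exp (t : ℝ)⁻¹ ^ t := by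
          gcongr
          linarith [Real.add_one_le_exp (t : ℝ)⁻¹]
      _ = Real.exp 1 := by rw [← Real.exp_nat_mul, mul_inv_cancel₀ ht0.ne']
  calc _ ≤ Real.exp 1 * (t : ℝ) ^ M / (t : ℝ) ^ (M + 2) := by
        gcongr
        exact two_pow_floor_mul_log_le hM ht
    _ = Real.exp 1 * (t : ℝ) ^ (-2 : ℝ) := by
        rw [mul_div_assoc, ← Real.rpow_sub ht0, sub_add_cancel_left]

/-- The event that, in round `i + 1`, the conditional probability of pulling `l` times `q` is at
most half that of pulling `k`, up to an error `η`. -/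
def dominatedRounds {K : ℕ} {Ω : Type*} (π : Policy K) (A : ℕ → Ω → Fin K) (R : ℕ → Ω → ℝ)
    (k l : Fin K) (q η : ℝ) (i : ℕ) : Set Ω :=
  {ω | q * (π i (history A R i ω)).real {l} ≤ η + 2⁻¹ * (π i (history A R i ω)).real {k}}

lemma measurable_real_apply_singleton {K : ℕ} (π : Policy K) (i : ℕ) (k : Fin K) :
    Measurable fun h : History K i => (π i h).real {k} :=
  ((π i).measurable_coe (measurableSet_singleton k)).ennreal_toReal

lemma measurableSet_dominatedRounds {K : ℕ} {Ω : Type*} (π : Policy K) (A : ℕ → Ω → Fin K)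
    (R : ℕ → Ω → ℝ) (k l : Fin K) (q η : ℝ) (i : ℕ) :
    MeasurableSet[past A R i] (dominatedRounds π A R k l q η i) :=
  measurableSet_past_history (measurableSet_le
    ((measurable_real_apply_singleton π i l).const_mul q)
    (((measurable_real_apply_singleton π i k).const_mul 2⁻¹).const_add η))

section Dominated

universe u

variable {K : ℕ} {Θ : Type*} {μ : Fin K → Θ → ℝ} {θstar : Θ} {σ : ℝ≥0} {Q : Policy K → Prop}

open Classical in
lemma summablyRare_le_count_dominatedRounds {k l : Fin K} (hne : l ≠ k) {M ρ : ℝ} (hM : 0 ≤ M)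
    (hρ0 : 0 ≤ ρ) (hρ : ρ < 1) {m : ℕ} (hm : m ≠ 0) :
    SummablyRare (fun r : BanditRun.{u} μ θstar σ Q => r.P) fun r t => {ω |
      t / m ≤ Nat.count (fun i => r.A i ω = l ∧
        ω ∈ dominatedRounds r.π r.A r.R k l ((t : ℝ) ^ (-ρ)) (t : ℝ)⁻¹ i) t ∧
      pullCount r.A k t ω ≤ ⌊M * Real.log t⌋₊} := by
  refine SummablyRare.of_eventually_le
    ((Real.summable_nat_rpow.2 (by norm_num : (-2 : ℝ) < -1)).mul_left (Real.exp 1)) ?_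
  filter_upwards [eventually_one_add_inv_pow_mul_two_pow_div_le hM hρ0 hρ hm] with t ht r
  refine (r.isRun.measureReal_le_count_pullCount_le_le hne
    (q := (t : ℝ≥0) ^ (-ρ)) (η := (t : ℝ≥0)⁻¹)
    (measurableSet_dominatedRounds r.π r.A r.R k l ((t : ℝ) ^ (-ρ)) (t : ℝ)⁻¹)
    (fun i _ ω hω => ?_) _ _).trans ?_
  · simpa [dominatedRounds] using hω
  · simpa using ht

end Dominated

/-! ### TS-C -/

section TSRun

universe u

variable {K : ℕ} {Θ : Type*} {μ : Fin K → Θ → ℝ} {θstar : Θ} {kstar : Fin K} {α : ℝ}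
  {β σ : ℝ≥0}

lemma IsTSC.mem_dominatedRounds {Ω : Type*} {π : Policy K}
    (hπ : IsTSC μ α β σ π) (hopt : ∀ k, μ k θstar ≤ μ kstar θstar) (hσ : 0 < σ) (hβ : 0 < β)
    {A : ℕ → Ω → Fin K} {R : ℕ → Ω → ℝ} {i t : ℕ} {ω : Ω} {a a' M q : ℝ} (ha : 0 ≤ a)
    (ha' : 0 ≤ a') (ht : t ≠ 0) (hit : i ≤ t) (hlog : a * Real.log t ≤ α * Real.log i)
    (hacc : AccurateUpTo μ θstar a σ A R t ω)
    (hacc_star : pullCount A kstar i ω ≠ 0 → |empMean (history A R i ω) kstar - μ kstar θstar| <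
      radius a' σ t (pullCount A kstar i ω))
    (hstarved : (pullCount A kstar t ω : ℝ) ≤ M * Real.log t) {N : ℕ} (hN : N ≠ 0)
    (hMN : (√(2 * a) + √(2 * β)) ^ 2 * M / β * Real.log t ^ 2 ≤ N)
    (hq : 2 * q ≤ (√(2 * Real.pi))⁻¹ *
      Real.exp (-(1 + √(2 * (a' / β * Real.log t)) + 1) ^ 2 / 2))
    {l : Fin K} (hl : N ≤ pullCount A l i ω) :
    ω ∈ dominatedRounds π A R kstar l q (t : ℝ)⁻¹ i := by
  have := Real.log_natCast_nonneg t
  refine hπ.mul_real_apply_le hopt hσ hβ (hacc.mem_confSet hit hlog) ha ha' ht hN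
    (by rwa [pulls_history]) ?_ (by rwa [pulls_history]) ?_ hq <;> rw [pulls_history]
  · exact hacc l i hit (hN.bot_lt.trans_le hl).ne'
  · have hmono : (pullCount A kstar i ω : ℝ) ≤ pullCount A kstar t ω := by
      exact_mod_cast Nat.count_monotone _ hit
    calc (√(2 * a) + √(2 * β)) ^ 2 * Real.log t * pullCount A kstar i ω
        ≤ (√(2 * a) + √(2 * β)) ^ 2 * Real.log t * (M * Real.log t) := by
          gcongr
          exact hmono.trans hstarved
      _ = β * ((√(2 * a) + √(2 * β)) ^ 2 * M / β * Real.log t ^ 2) := by field_simp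
      _ ≤ β * N := by gcongr

lemma IsTSC.summablyRare_pullCount_lt (hopt : ∀ k, μ k θstar ≤ μ kstar θstar) (hσ : 0 < σ)
    (hα : 2 < α) (hβ : 1 < β) {M : ℝ} (hM : 0 < M) :
    SummablyRare (fun r : BanditRun.{u} μ θstar σ (IsTSC μ α β σ) => r.P)
      fun r t => {ω | (pullCount r.A kstar t ω : ℝ) < M * Real.log t} := by
  classical
  obtain ⟨a, ha, haα⟩ := exists_between hα
  obtain ⟨a', ha', ha'β⟩ := exists_between (show (1 : ℝ) < β by exact_mod_cast hβ)
  have hK : 2 * Fintype.card (Fin K) ≠ 0 := by simpa using kstar.pos.ne'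
  have hβ0 : 0 < β := zero_lt_one.trans hβ
  have hρ0 : 0 ≤ a' / β := by positivity
  have hρ1 : a' / β < 1 := (div_lt_one (by positivity)).2 ha'β
  refine (((summablyRare_not_accurateUpTo hσ ha).union
    (summablyRare_deviation_floor_log hσ ha' hM.le kstar)).union
    (SummablyRare.iUnion fun l : {l // l ≠ kstar} => summablyRare_le_count_dominatedRounds l.2
      (ρ := (1 + a' / β) / 2) hM.le (by positivity) (by linarith) hK)).mono ?_
  filter_upwards [eventually_ge_atTop 2, eventually_mul_log_le_mul_log (by linarith) haα hK,
    eventually_mul_log_le_natDiv M hK,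
    eventually_mul_log_sq_le_natDiv ((√(2 * a) + √(2 * β)) ^ 2 * M / β) hK,
    eventually_two_mul_rpow_le_gaussian_tail hρ0 hρ1] with t ht hlog hMt hMt_sq htail r
  refine ae_of_all _ fun ω hstarved => ?_
  by_contra! hcon
  simp only [Set.mem_union, not_or, Set.mem_iUnion, not_exists] at hcon
  obtain ⟨⟨hacc, hdev⟩, hdom⟩ := hcon
  have hfloor : pullCount r.A kstar t ω ≤ ⌊M * Real.log t⌋₊ := Nat.le_floor hstarved.le
  have hlt : pullCount r.A kstar t ω < t / (2 * Fintype.card (Fin K)) := by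
    exact_mod_cast hstarved.trans_le hMt
  obtain ⟨l, hne, hl⟩ := exists_ne_le_count_and_le_count (fun i => r.A i ω) hlt
  have hN : t / (2 * Fintype.card (Fin K)) ≠ 0 := (Nat.zero_le _).trans_lt hlt |>.ne'
  refine hdom ⟨l, hne⟩ ⟨hl.trans (Nat.count_mono_left fun i hit ⟨hi, hNi⟩ => ⟨hi, ?_⟩), hfloor⟩
  refine r.policy_mem.mem_dominatedRounds hopt hσ hβ0 (by linarith) (by linarith) (by positivity)
    hit.le (hlog i (hNi.trans (Nat.count_le _))) (not_not.1 hacc) (fun h0 => ?_) hstarved.le hN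
    hMt_sq htail hNi
  exact not_le.1 fun hge => hdev
    ⟨i, hit.le, h0, (Nat.count_monotone _ hit.le).trans hfloor, hge⟩

lemma summablyRare_arm_and_real_apply_le {Q : Policy K → Prop} {f : ℕ → ℝ} (hf : Summable f)
    (hf0 : ∀ t, 0 ≤ f t) (k : Fin K) :
    SummablyRare (fun r : BanditRun.{u} μ θstar σ Q => r.P) fun r t =>
      {ω | r.A t ω = k} ∩ {ω | (r.π t (history r.A r.R t ω)).real {k} ≤ f t} :=
  .of_eventually_le hf <| Eventually.of_forall fun t r => r.isRun.measureReal_inter_le t k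
    (measurableSet_past_history
      (measurableSet_le (measurable_real_apply_singleton r.π t k) measurable_const))
    (hf0 t) fun _ hω => hω

lemma IsTSC.exists_summablyRare_arm (hopt : ∀ k, μ k θstar ≤ μ kstar θstar) (hσ : 0 < σ)
    (hα : 2 < α) (hβ : 1 < β) {k : Fin K} (hk : μ k θstar < μ kstar θstar) :
    ∃ L : ℝ, 0 ≤ L ∧ SummablyRare (fun r : BanditRun.{u} μ θstar σ (IsTSC μ α β σ) => r.P)
      fun r t => {ω | r.A t ω = k ∧ L * Real.log t ≤ pullCount r.A k t ω} := by
  have hε : 0 < (μ kstar θstar - μ k θstar) / 4 := by linarith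
  set ε := (μ kstar θstar - μ k θstar) / 4 with hε_def
  have hβ0 : 0 < β := zero_lt_one.trans hβ
  set L : ℝ := 2 * α * σ ^ 2 / ε ^ 2 + 2 * (2 * β) * σ ^ 2 / ε ^ 2
  have hL : 0 < L := by positivity
  refine ⟨L, hL.le, (((summablyRare_notMem_confSet hσ hα).union
    (IsTSC.summablyRare_pullCount_lt hopt hσ hα hβ hL)).union
    (summablyRare_arm_and_real_apply_le (f := fun t : ℕ => 2 * (t : ℝ) ^ (-2 : ℝ))
      ((Real.summable_nat_rpow.2 (by norm_num)).mul_left 2) (fun t => by positivity) k)).mono ?_⟩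
  filter_upwards [eventually_ge_atTop 2] with t ht r
  refine ae_of_all _ fun ω ⟨hA, hn⟩ => or_iff_not_imp_left.2 fun hcon => ⟨hA, ?_⟩
  simp only [Set.mem_union, Set.mem_ofPred_eq, not_or, not_not, not_lt] at hcon
  obtain ⟨hθ, hn_star⟩ := hcon
  have hlog : 0 < Real.log t := Real.log_pos (by exact_mod_cast ht)
  have hsmall (j : Fin K) (hj : L * Real.log t ≤ pullCount r.A j t ω) :
      pulls (history r.A r.R t ω) j ≠ 0 ∧ width α σ (history r.A r.R t ω) j +
        radius (2 * β) σ t (pulls (history r.A r.R t ω) j) ≤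
          (μ kstar θstar - μ k θstar) / 2 := by
    rw [width_eq_radius, pulls_history]
    have hα_radius : radius α σ t (pullCount r.A j t ω) ≤ ε := radius_le hε <| le_trans
      (mul_le_mul_of_nonneg_right (le_add_of_nonneg_right (by positivity)) hlog.le) hj
    have hβ_radius : radius (2 * β) σ t (pullCount r.A j t ω) ≤ ε := radius_le hε <| le_trans
      (mul_le_mul_of_nonneg_right (le_add_of_nonneg_left (by positivity)) hlog.le) hj
    exact ⟨by exact_mod_cast ((mul_pos hL hlog).trans_le hj).ne', by linarith⟩
  obtain ⟨hk0, hk_gap⟩ := hsmall k hn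
  obtain ⟨hstar0, hstar_gap⟩ := hsmall kstar hn_star
  exact r.policy_mem.real_apply_le_two_mul_rpow hopt hσ hβ0 hθ (by positivity) zero_le_two hk0
    hstar0 hk_gap hstar_gap

end TSRun

end StructuredBandit

open StructuredBandit in
theorem theorem1_general.{u, v, w} {K : ℕ} {Θ : Type w} {μ : Fin K → Θ → ℝ} {θstar : Θ}
    {kstar : Fin K} (hopt : ∀ k, μ k θstar ≤ μ kstar θstar) {σ : ℝ≥0} (hσ : 0 < σ) {α : ℝ}
    (hα : 2 < α) {β : ℝ≥0} (hβ : 1 < β) :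
    HasRegretBound.{u} μ θstar kstar σ (IsUCBC μ α σ) ∧
      HasRegretBound.{v} μ θstar kstar σ (IsTSC μ α β σ) :=
  ⟨hasRegretBound_of_summablyRare hopt
      (fun _ hk => IsUCBC.exists_summablyRare_arm hopt hσ hα hk)
      (fun _ hk => summablyRare_arm_of_not_competitive hσ hα
        (fun _ hπ t h k hk => (hπ t h k hk).1)
        (fun _ hM => IsUCBC.summablyRare_pullCount_lt hopt hσ hα hM) hk),
    hasRegretBound_of_summablyRare hopt
      (fun _ hk => IsTSC.exists_summablyRare_arm hopt hσ hα hβ hk)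
      (fun _ hk => summablyRare_arm_of_not_competitive hσ hα
        (fun _ hπ _ _ _ hk => hπ.mem_candidates hk)
        (fun _ hM => IsTSC.summablyRare_pullCount_lt hopt hσ hα hβ hM) hk)⟩

theorem theorem1 {K : ℕ} {Θ : Type*} (μ : Fin K → Θ → ℝ) (θstar : Θ) (kstar : Fin K)
    (hopt : ∀ k, μ k θstar ≤ μ kstar θstar)
    (σ : ℝ≥0) (hσ : 0 < σ) (α : ℝ) (hα : 3 < α) (β : ℝ≥0) (hβ : 1 < β) :
    -- UCB-C
    (∃ c₁ c₂ : ℝ, 0 ≤ c₁ ∧ 0 ≤ c₂ ∧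
      ∀ (ν : Kernel (Fin K) ℝ) [IsMarkovKernel ν], StructuredBandit.IsRewardLaw μ θstar σ ν →
      ∀ (π : StructuredBandit.Policy K) [∀ t, IsMarkovKernel (π t)],
        StructuredBandit.IsUCBC μ α σ π →
      ∀ {Ω : Type*} [MeasurableSpace Ω] (P : Measure Ω) [IsProbabilityMeasure P]
        (A : ℕ → Ω → Fin K) (R : ℕ → Ω → ℝ), StructuredBandit.IsRun π ν P A R →
        (∀ T : ℕ, 2 ≤ T → StructuredBandit.expRegret μ kstar θstar P A T ≤
          ((StructuredBandit.numCompetitive μ kstar θstar : ℝ) - 1) * (c₁ * Real.log T) +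
          ((K : ℝ) - (StructuredBandit.numCompetitive μ kstar θstar : ℝ)) * c₂) ∧
        (StructuredBandit.numCompetitive μ kstar θstar = 1 →
          ∀ T : ℕ, StructuredBandit.expRegret μ kstar θstar P A T ≤ ((K : ℝ) - 1) * c₂)) ∧
    -- TS-C
    (∃ c₁ c₂ : ℝ, 0 ≤ c₁ ∧ 0 ≤ c₂ ∧
      ∀ (ν : Kernel (Fin K) ℝ) [IsMarkovKernel ν], StructuredBandit.IsRewardLaw μ θstar σ ν →
      ∀ (π : StructuredBandit.Policy K) [∀ t, IsMarkovKernel (π t)],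
        StructuredBandit.IsTSC μ α β σ π →
      ∀ {Ω : Type*} [MeasurableSpace Ω] (P : Measure Ω) [IsProbabilityMeasure P]
        (A : ℕ → Ω → Fin K) (R : ℕ → Ω → ℝ), StructuredBandit.IsRun π ν P A R →
        (∀ T : ℕ, 2 ≤ T → StructuredBandit.expRegret μ kstar θstar P A T ≤
          ((StructuredBandit.numCompetitive μ kstar θstar : ℝ) - 1) * (c₁ * Real.log T) +
          ((K : ℝ) - (StructuredBandit.numCompetitive μ kstar θstar : ℝ)) * c₂) ∧
        (StructuredBandit.numCompetitive μ kstar θstar = 1 →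
          ∀ T : ℕ, StructuredBandit.expRegret μ kstar θstar P A T ≤ ((K : ℝ) - 1) * c₂)) :=
  theorem1_general hopt hσ (by linarith) hβ
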